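/- Let $G$ be a Carnot group of step $2$ with Lie algebra $\mathfrak g=\mathcal H\oplus\mathcal V$, where $[\mathcal H,\mathcal H]=\mathcal V\neq\{0\}$, $[\mathcal H,\mathcal V]=\{0\}$, $\dim\mathfrak g<\infty$, and $\mathcal H$ carries an inner product $\langle\cdot,\cdot\rangle_{\mathcal H}$ with norm $|\cdot|_{\mathcal H}$. As usual $G$ is identified with $\mathfrak g$ by exponential coordinates of the first kind, so that $\exp$ is the identity, $x\star y=x+y+\tfrac12[x,y]$, the neutral element is $e=0$, and the dilations are $D_a(h,v)=(ah,a^2v)$. For an absolutely continuous path $\gamma:[0,1]\to G$ let $c_\gamma(t)=(L_{\gamma(t)^{-1}})_*\gamma'(t)$, where $L_x$ is left translation; $\gamma$ is horizontal if $c_\gamma(t)\in\mathcal H$ for a.e. $t$. The Carnot–Carathéodory distance is $$\rho_{cc}(x,y)=\inf\Big\{\int_0^1|c_\gamma(t)|_{\mathcal H}\,dt:\ \gamma\text{ horizontal},\ \gamma(0)=x,\ \gamma(1)=y\Big\},\qquad d_{cc}(x)=\rho_{cc}(e,x).$$ Let $X_1,X_2,\dots$ be i.i.d. standard normal $\mathcal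 N(0,\mathrm{Id})$ random vectors in $\mathcal H$, let $S_n=\exp(X_1)\star\cdots\star\exp(X_n)$, and let $\mu_n$ be the distribution of $D_{1/n}S_n$. Put $\Lambda(\lambda)=\log\mathbb E\,e^{\langle\lambda,X_1\rangle_{\mathcal H}}$, $\Lambda^*(u)=\sup_{\lambda\in\mathcal H}(\langle\lambda,u\rangle_{\mathcal H}-\Lambda(\lambda))$ and $$J_{\mathcal N}(x)=\inf\Big\{\int_0^1\Lambda^*(c_\gamma(t))\,dt:\ \gamma\text{ horizontal},\ \gamma(0)=e,\ \gamma(1)=x\Big\}.$$ Then $d_{cc}$ is finite on $G$, and for every $x\in G$ $$J_{\mathcal N}(x)=\inf\Big\{\tfrac12\int_0^1|c_\gamma(t)|_{\mathcal H}^2\,dt:\ \gamma\text{ horizontal},\ \gamma(0)=e,\ \gamma(1)=x\Big\}=\tfrac12\,d_{cc}(x)^2 .$$ Moreover $(\mu_n)_{n\ge1}$ satisfies the large deviation principle on $(G,\rho_{cc})$ with rate function $J_{\mathcal N}=\tfrac12 d_{cc}^2$: this function is not identically $\infty$, its sublevel sets are closed, and for all open $O\subset G$ and all closed $F\subset G$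 (in the topology of $\rho_{cc}$) $$\liminf_{n\to\infty}\tfrac1n\log\mu_n(O)\ \ge\ -\inf_{O}\tfrac12 d_{cc}^2,\qquad \limsup_{n\to\infty}\tfrac1n\log\mu_n(F)\ \le\ -\inf_{F}\tfrac12 d_{cc}^2 .$$ -/

import Mathlib

open MeasureTheory ProbabilityTheory Filter Topology Set
open scoped ENNReal NNReal InnerProductSpace

noncomputable section

/-! ## Carnot groups of step two

`H` is the horizontal layer, with its inner product; `V` is the second layer.
-/

/-- The bracket data of a Lie algebra stratified with two layers, `𝔤 = H ⊕ V`: the only nonzero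
brackets are those of horizontal vectors, they lie in `V`, and they span `V`. -/
structure StepTwoBracket (H V : Type*) [NormedAddCommGroup H] [InnerProductSpace ℝ H]
    [NormedAddCommGroup V] [NormedSpace ℝ V] where
  /-- the bracket of two horizontal vectors -/
  br : H →ₗ[ℝ] H →ₗ[ℝ] V
  br_self : ∀ x, br x x = 0
  span_br : Submodule.span ℝ {v | ∃ x y, br x y = v} = ⊤

/-- The Carnot group of step two with Lie algebra `𝔤 = H ⊕ V`, in exponential coordinates of the
first kind: both `G` and `𝔤` are the vector space `H × V`, the exponential map is the identity,
`𝔤` carries the bracket `⁅(h, v), (h', v')⁆ = (0, br h h')`, and the product of `G` is given by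
the Baker-Campbell-Dynkin-Hausdorff formula. -/
def CarnotGroup {H V : Type*} [NormedAddCommGroup H] [InnerProductSpace ℝ H]
    [NormedAddCommGroup V] [NormedSpace ℝ V] (_B : StepTwoBracket H V) : Type _ := H × V

namespace CarnotGroup

variable {H V : Type*} [NormedAddCommGroup H] [InnerProductSpace ℝ H]
  [NormedAddCommGroup V] [NormedSpace ℝ V] {B : StepTwoBracket H V}

/-- Only the resulting topology and differentiable structure of the coordinate space are used. -/
instance : NormedAddCommGroup (CarnotGroup B) := inferInstanceAs (NormedAddCommGroup (H × V))

instance : NormedSpace ℝ (CarnotGroup B) := inferInstanceAs (NormedSpace ℝ (H × V))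

instance : MeasurableSpace (CarnotGroup B) := borel _

instance : BorelSpace (CarnotGroup B) := ⟨rfl⟩

/-- The element with given coordinates. -/
def mk (h : H) (v : V) : CarnotGroup B := (h, v)

/-- The projection of `𝔤` onto the first layer. -/
def hor : CarnotGroup B →ₗ[ℝ] H := LinearMap.fst ℝ H V

/-- The projection of `𝔤` onto the second layer. -/
def ver : CarnotGroup B →ₗ[ℝ] V := LinearMap.snd ℝ H V

@[simp] theorem hor_mk (h : H) (v : V) : hor (mk h v : CarnotGroup B) = h := rfl

@[simp] theorem ver_mk (h : H) (v : V) : ver (mk h v : CarnotGroup B) = v := rfl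

theorem ext_coord {x y : CarnotGroup B} (h₁ : hor x = hor y) (h₂ : ver x = ver y) : x = y :=
  Prod.ext h₁ h₂

instance : Bracket (CarnotGroup B) (CarnotGroup B) := ⟨fun x y => mk 0 (B.br (hor x) (hor y))⟩

@[simp] theorem hor_bracket (x y : CarnotGroup B) : hor ⁅x, y⁆ = 0 := rfl

@[simp] theorem ver_bracket (x y : CarnotGroup B) : ver ⁅x, y⁆ = B.br (hor x) (hor y) := rfl

instance : LieRing (CarnotGroup B) where
  add_lie x y z := by apply ext_coord <;> simp
  lie_add x y z := by apply ext_coord <;> simp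
  lie_self x := by apply ext_coord <;> simp [B.br_self]
  leibniz_lie x y z := by apply ext_coord <;> simp

instance : LieAlgebra ℝ (CarnotGroup B) where
  lie_smul t x y := by apply ext_coord <;> simp

/-- The horizontal layer `V₁` of the stratification. -/
def layerOne (B : StepTwoBracket H V) : Submodule ℝ (CarnotGroup B) := LinearMap.ker ver

/-- The second layer `V₂` of the stratification. -/
def layerTwo (B : StepTwoBracket H V) : Submodule ℝ (CarnotGroup B) := LinearMap.ker hor

/-- `𝔤 = V₁ ⊕ V₂`. -/
theorem isCompl_layers : IsCompl (layerOne B) (layerTwo B) := by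
  constructor
  · rw [Submodule.disjoint_def]
    intro x h₁ h₂
    exact ext_coord (by simpa [layerTwo] using h₂) (by simpa [layerOne] using h₁)
  · rw [codisjoint_iff, Submodule.eq_top_iff']
    intro x
    refine Submodule.mem_sup.2 ⟨mk (hor x) 0, ?_, mk 0 (ver x), ?_, ?_⟩
    · simp [layerOne]
    · simp [layerTwo]
    · apply ext_coord <;> simp

/-- `[V₁, V₁] = V₂`. -/
theorem span_bracket_layerOne :
    Submodule.span ℝ {z | ∃ x ∈ layerOne B, ∃ y ∈ layerOne B, ⁅x, y⁆ = z} = layerTwo B := by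
  apply le_antisymm
  · rw [Submodule.span_le]
    rintro _ ⟨x, -, y, -, rfl⟩
    simp [layerTwo]
  · intro z hz
    let ι : V →ₗ[ℝ] CarnotGroup B := LinearMap.inr ℝ H V
    have hz' : z = ι (ver z) := ext_coord (show hor z = 0 from hz) rfl
    have h : ver z ∈ Submodule.span ℝ {v | ∃ x y, B.br x y = v} := by simp [B.span_br]
    have h' := Submodule.mem_map_of_mem (f := ι) h
    rw [Submodule.map_span, ← hz'] at h'
    refine Submodule.span_mono ?_ h'
    rintro _ ⟨_, ⟨x, y, rfl⟩, rfl⟩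
    exact ⟨mk x 0, by simp [layerOne], mk y 0, by simp [layerOne], rfl⟩

/-- `[V₁, V₂] = 0`. -/
theorem bracket_layerOne_layerTwo {x y : CarnotGroup B} (_hx : x ∈ layerOne B)
    (hy : y ∈ layerTwo B) : ⁅x, y⁆ = 0 := by
  have hy' : hor y = 0 := hy
  apply ext_coord <;> simp [hy']

/-- The group law: the Baker-Campbell-Dynkin-Hausdorff formula in step two. -/
instance : Mul (CarnotGroup B) := ⟨fun x y => x + y + (1 / 2 : ℝ) • ⁅x, y⁆⟩

instance : One (CarnotGroup B) := ⟨0⟩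

instance : Inv (CarnotGroup B) := ⟨fun x => -x⟩

theorem mul_def (x y : CarnotGroup B) : x * y = x + y + (1 / 2 : ℝ) • ⁅x, y⁆ := rfl

theorem one_def : (1 : CarnotGroup B) = 0 := rfl

theorem inv_def (x : CarnotGroup B) : x⁻¹ = -x := rfl

instance : Group (CarnotGroup B) :=
  Group.ofLeftAxioms
    (fun x y z => by
      apply ext_coord
      · simp [mul_def, add_assoc]
      · simp [mul_def]
        abel)
    (fun x => by apply ext_coord <;> simp [mul_def, one_def])
    (fun x => by apply ext_coord <;> simp [mul_def, one_def, inv_def])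

/-- The exponential map on horizontal vectors. -/
def expH (h : H) : CarnotGroup B := mk h 0

/-- The dilation `D_a`: multiplication by `a` on the first layer, by `a ^ 2` on the second. -/
def dil (a : ℝ) (x : CarnotGroup B) : CarnotGroup B := mk (a • hor x) (a ^ 2 • ver x)

/-! ## Horizontal paths and the Carnot-Carathéodory distance -/

/-- The Maurer-Cartan form `c_γ(t) = (L_{γ(t)⁻¹})_* γ'(t)`, an element of `T_e G = 𝔤`. -/
def maurerCartan (γ : ℝ → CarnotGroup B) (t : ℝ) : CarnotGroup B :=
  fderiv ℝ (fun y : CarnotGroup B => (γ t)⁻¹ * y) (γ t) (deriv γ t)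

/-- A path on `[0, 1]` is horizontal if it is absolutely continuous and its Maurer-Cartan form is
almost everywhere in the horizontal layer. (Values outside `[0, 1]` play no role.) -/
def IsHorizontal (γ : ℝ → CarnotGroup B) : Prop :=
  AbsolutelyContinuousOnInterval γ 0 1 ∧
    ∀ᵐ t ∂(volume.restrict (Icc (0 : ℝ) 1)), maurerCartan γ t ∈ layerOne B

/-- The horizontal paths from `x` to `y`. -/
def horizontalPaths (x y : CarnotGroup B) : Set (ℝ → CarnotGroup B) :=
  {γ | IsHorizontal γ ∧ γ 0 = x ∧ γ 1 = y}

/-- The length of a horizontal path. -/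
def pathLength (γ : ℝ → CarnotGroup B) : ℝ≥0∞ :=
  ∫⁻ t in Icc (0 : ℝ) 1, ‖hor (maurerCartan γ t)‖ₑ

/-- The energy of a horizontal path. -/
def energy (γ : ℝ → CarnotGroup B) : ℝ≥0∞ :=
  ∫⁻ t in Icc (0 : ℝ) 1, ‖hor (maurerCartan γ t)‖ₑ ^ 2

/-- The Carnot-Carathéodory distance (`∞` if no horizontal path joins the points). -/
def rhoCC (x y : CarnotGroup B) : ℝ≥0∞ := ⨅ γ ∈ horizontalPaths x y, pathLength γ

/-- The Carnot-Carathéodory distance from the identity. -/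
def dCC (x : CarnotGroup B) : ℝ≥0∞ := rhoCC 1 x

/-- The topology of the Carnot-Carathéodory distance. -/
@[reducible] def ccTopology (B : StepTwoBracket H V) : TopologicalSpace (CarnotGroup B) where
  IsOpen U := ∀ x ∈ U, ∃ ε : ℝ≥0∞, 0 < ε ∧ ∀ y, rhoCC x y < ε → y ∈ U
  isOpen_univ _ _ := ⟨1, one_pos, fun _ _ => mem_univ _⟩
  isOpen_inter U W hU hW x hx := by
    obtain ⟨ε, hε, h⟩ := hU x hx.1
    obtain ⟨δ, hδ, h'⟩ := hW x hx.2
    exact ⟨min ε δ, lt_min hε hδ, fun y hy =>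
      ⟨h y (hy.trans_le (min_le_left _ _)), h' y (hy.trans_le (min_le_right _ _))⟩⟩
  isOpen_sUnion 𝒰 h𝒰 x hx := by
    obtain ⟨U, hU, hxU⟩ := hx
    obtain ⟨ε, hε, h⟩ := h𝒰 U hU x hxU
    exact ⟨ε, hε, fun y hy => ⟨U, hU, h y hy⟩⟩

end CarnotGroup

/-! ## Large deviations -/

/-- A rate function: not identically infinite, with closed sublevel sets. -/
def IsRateFunction {M : Type*} (τ : TopologicalSpace M) (I : M → ℝ≥0∞) : Prop :=
  (∃ x, I x ≠ ∞) ∧ ∀ a : ℝ≥0, IsClosed[τ] {x | I x ≤ a}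

/-- The large deviation principle with speed `n` and rate function `I`, for the topology `τ`. -/
def SatisfiesLDP {M : Type*} [MeasurableSpace M] (τ : TopologicalSpace M) (μ : ℕ → Measure M)
    (I : M → ℝ≥0∞) : Prop :=
  IsRateFunction τ I ∧
  (∀ O : Set M, IsOpen[τ] O →
    -((⨅ x ∈ O, I x : ℝ≥0∞) : EReal) ≤
      liminf (fun n : ℕ => (((n : ℝ)⁻¹ : ℝ) : EReal) * ENNReal.log (μ n O)) atTop) ∧
  (∀ F : Set M, IsClosed[τ] F →
    limsup (fun n : ℕ => (((n : ℝ)⁻¹ : ℝ) : EReal) * ENNReal.log (μ n F)) atTop ≤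
      -((⨅ x ∈ F, I x : ℝ≥0∞) : EReal))

section Cramer

variable {H : Type*} [NormedAddCommGroup H] [InnerProductSpace ℝ H] [MeasurableSpace H]

/-- The logarithmic moment generating function `Λ` of a law on `H`. -/
def logMGF (μ : Measure H) (w : H) : EReal :=
  ENNReal.log (∫⁻ x, ENNReal.ofReal (Real.exp ⟪w, x⟫_ℝ) ∂μ)

/-- The Legendre transform `Λ*`. -/
def legendre (μ : Measure H) (u : H) : EReal := ⨆ w : H, ((⟪w, u⟫_ℝ : ℝ) : EReal) - logMGF μ w

variable {V : Type*} [NormedAddCommGroup V] [NormedSpace ℝ V] {B : StepTwoBracket H V}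

/-- `J(x) = inf ∫₀¹ Λ*(c_γ(t)) dt` over the horizontal paths `γ` from `e` to `x`. The integrand is
nonnegative for a probability law, since then `Λ(0) = 0`. -/
def rateJ (μ : Measure H) (x : CarnotGroup B) : ℝ≥0∞ :=
  ⨅ γ ∈ CarnotGroup.horizontalPaths 1 x,
    ∫⁻ t in Icc (0 : ℝ) 1, (legendre μ (CarnotGroup.hor (CarnotGroup.maurerCartan γ t))).toENNReal

/-- The random walk `S_n = exp(X_1) ⋯ exp(X_n)`; the steps are enumerated from `0`. -/
def randomWalk {Ω : Type*} (B : StepTwoBracket H V) (X : ℕ → Ω → H) (n : ℕ) (ω : Ω) :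
    CarnotGroup B :=
  ((List.range n).map fun k => CarnotGroup.expH (X k ω)).prod

/-- The distribution `μ_n` of `D_{1/n} S_n`. -/
def walkLaw {Ω : Type*} [MeasurableSpace Ω] (B : StepTwoBracket H V) (P : Measure Ω)
    (X : ℕ → Ω → H) (n : ℕ) : Measure (CarnotGroup B) :=
  P.map fun ω => CarnotGroup.dil ((n : ℝ)⁻¹) (randomWalk B X n ω)

end Cramer

end

/-! The bridge between the geometry and the probability is `wordNorm`: the infimum of the total
length of finite products of horizontal exponentials equal to a given element. A vertical element
`v` is a product of commutators of total length at most `C √‖v‖` (`exists_wordProd_vertical`), so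
errors in the second layer are cheap once they are small.

`rhoCC_eq` identifies `rhoCC x y` with `wordNorm (x⁻¹ * y)`. A word gives a path by concatenating
one-parameter subgroups. Conversely, cut a horizontal path into short pieces: the horizontal parts
of the increments form a word no longer than the path, while the vertical defects are quadratic in
the lengths of the pieces and vanish in the limit. Cauchy–Schwarz and constant-speed paths then
relate energy to squared length, and `Λ* = ‖·‖² / 2` for the Gaussian law.

Upper bound: cut the `n` steps into a fixed number `m` of blocks. Up to a small vertical error, the
word norm of the rescaled walk is at most the sum of the norms of the block sums. The normalized
block sums are a contraction of a standard Gaussian vector into dimension `m dim H`, so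
`lintegral_exp_norm_sq_contraction_le` gives the Gaussian rate with a prefactor independent of `n`.
Since the rate is a function of the distance to the identity, a closed set may be replaced by the
complement of a ball, and no compactness argument is needed.

Lower bound: discretize a path from the identity to the target of speed at most `r`, and shift the
Gaussian steps by its increments. Cameron–Martin on a symmetric set (`exp_mul_stdGaussian_le_shift`)
makes this cost at most `exp (-n r² / 2)`. The set is an event of small fluctuations with
probability at least `1 / 2`, on which the walk ends near the target. -/

set_option linter.unusedSectionVars false

noncomputable section

/-! ### Coordinates, dilations and walks -/

namespace CarnotGroup

variable {H V : Type*} [NormedAddCommGroup H] [InnerProductSpace ℝ H]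
  [NormedAddCommGroup V] [NormedSpace ℝ V] {B : StepTwoBracket H V}

@[simp] theorem hor_mul (x y : CarnotGroup B) : hor (x * y) = hor x + hor y := by
  simp [mul_def]

@[simp] theorem ver_mul (x y : CarnotGroup B) :
    ver (x * y) = ver x + ver y + (1 / 2 : ℝ) • B.br (hor x) (hor y) := by
  simp [mul_def]

@[simp] theorem hor_one : hor (1 : CarnotGroup B) = 0 := rfl

@[simp] theorem ver_one : ver (1 : CarnotGroup B) = 0 := rfl

@[simp] theorem hor_inv (x : CarnotGroup B) : hor x⁻¹ = -hor x := rfl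

@[simp] theorem ver_inv (x : CarnotGroup B) : ver x⁻¹ = -ver x := rfl

@[simp] theorem hor_expH (h : H) : hor (expH h : CarnotGroup B) = h := rfl

@[simp] theorem ver_expH (h : H) : ver (expH h : CarnotGroup B) = 0 := rfl

@[simp] theorem hor_dil (a : ℝ) (x : CarnotGroup B) : hor (dil a x) = a • hor x := rfl

@[simp] theorem ver_dil (a : ℝ) (x : CarnotGroup B) : ver (dil a x) = a ^ 2 • ver x := rfl

theorem br_swap (x y : H) : B.br y x = -B.br x y := by
  have h := B.br_self (x + y)
  simp only [map_add, LinearMap.add_apply, B.br_self, zero_add, add_zero] at h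
  exact eq_neg_of_add_eq_zero_right (by rw [← h]; abel)

theorem expH_inv (h : H) : (expH h : CarnotGroup B)⁻¹ = expH (-h) := by
  apply ext_coord <;> simp

theorem expH_zero : (expH 0 : CarnotGroup B) = 1 := by
  apply ext_coord <;> simp

theorem dil_mul (a : ℝ) (x y : CarnotGroup B) : dil a (x * y) = dil a x * dil a y := by
  apply ext_coord
  · simp
  · simp only [ver_dil, ver_mul, hor_dil, map_smul, LinearMap.smul_apply, smul_add, smul_smul]
    congr 2
    ring

theorem dil_expH (a : ℝ) (h : H) : dil a (expH h : CarnotGroup B) = expH (a • h) := by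
  apply ext_coord <;> simp

theorem dil_one (a : ℝ) : dil a (1 : CarnotGroup B) = 1 := by
  apply ext_coord <;> simp

/-- The end point of the walk with the first `n` of the steps `y 0, y 1, …`. -/
def walk (B : StepTwoBracket H V) (y : ℕ → H) (n : ℕ) : CarnotGroup B :=
  ((List.range n).map fun k => expH (y k)).prod

@[simp] theorem walk_zero (y : ℕ → H) : walk B y 0 = 1 := rfl

theorem walk_succ (y : ℕ → H) (n : ℕ) : walk B y (n + 1) = walk B y n * expH (y n) := by
  simp [walk, List.range_succ]

theorem dil_walk (a : ℝ) (y : ℕ → H) (n : ℕ) :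
    dil a (walk B y n) = walk B (fun k => a • y k) n := by
  induction n with
  | zero => simp [dil_one]
  | succ n ih => simp [walk_succ, dil_mul, dil_expH, ih]

theorem hor_walk (y : ℕ → H) (n : ℕ) : hor (walk B y n) = ∑ k ∈ Finset.range n, y k := by
  induction n with
  | zero => simp
  | succ n ih => simp [walk_succ, ih, Finset.sum_range_succ]

theorem ver_walk (y : ℕ → H) (n : ℕ) :
    ver (walk B y n) =
      (1 / 2 : ℝ) • ∑ k ∈ Finset.range n, B.br (∑ i ∈ Finset.range k, y i) (y k) := by
  induction n with
  | zero => simp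
  | succ n ih => simp [walk_succ, ih, Finset.sum_range_succ, hor_walk]

/-- Vertical elements are central. -/
theorem mk_zero_comm (v : V) (x : CarnotGroup B) : mk 0 v * x = x * mk 0 v := by
  apply ext_coord
  · simp
  · simp [add_comm]

theorem mk_zero_mul_mk_zero (v w : V) : (mk 0 v * mk 0 w : CarnotGroup B) = mk 0 (v + w) := by
  apply ext_coord <;> simp

theorem mk_zero_zero : (mk 0 0 : CarnotGroup B) = 1 := rfl

theorem eq_expH_mul_mk (x : CarnotGroup B) : x = expH (hor x) * mk 0 (ver x) := by
  apply ext_coord <;> simp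

/-- A sequence of points of the group, compared with the walk whose steps are the horizontal parts
of the increments. -/
theorem inv_mul_eq_walk_mul (g : ℕ → CarnotGroup B) (n : ℕ) :
    (g 0)⁻¹ * g n = walk B (fun k => hor ((g k)⁻¹ * g (k + 1))) n *
      mk 0 (∑ k ∈ Finset.range n, ver ((g k)⁻¹ * g (k + 1))) := by
  induction n with
  | zero => simp [mk_zero_zero]
  | succ n ih =>
    have h : (g 0)⁻¹ * g (n + 1) = (g 0)⁻¹ * g n * ((g n)⁻¹ * g (n + 1)) := by group
    rw [h, ih, walk_succ, Finset.sum_range_succ, ← mk_zero_mul_mk_zero]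
    conv_lhs => rw [eq_expH_mul_mk ((g n)⁻¹ * g (n + 1))]
    rw [mul_assoc, ← mul_assoc (mk 0 _), mk_zero_comm]
    simp only [mul_assoc]

/-! ### Words of horizontal vectors and the word norm -/

/-- The product of horizontal exponentials. -/
def wordProd (B : StepTwoBracket H V) (w : List H) : CarnotGroup B := (w.map expH).prod

/-- The length of a word of horizontal vectors. -/
def wordLen (w : List H) : ℝ := (w.map norm).sum

@[simp] theorem wordProd_nil : wordProd B ([] : List H) = 1 := rfl

@[simp] theorem wordLen_nil : wordLen ([] : List H) = 0 := rfl

@[simp] theorem wordProd_cons (x : H) (w : List H) :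
    wordProd B (x :: w) = expH x * wordProd B w := by simp [wordProd]

@[simp] theorem wordLen_cons (x : H) (w : List H) : wordLen (x :: w) = ‖x‖ + wordLen w := by
  simp [wordLen]

@[simp] theorem wordProd_append (w w' : List H) :
    wordProd B (w ++ w') = wordProd B w * wordProd B w' := by simp [wordProd]

@[simp] theorem wordLen_append (w w' : List H) :
    wordLen (w ++ w') = wordLen w + wordLen w' := by simp [wordLen]

theorem wordLen_nonneg (w : List H) : 0 ≤ wordLen w := by
  induction w with
  | nil => simp
  | cons x w ih => rw [wordLen_cons]; positivity

theorem exists_wordProd_inv (w : List H) :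
    ∃ w', wordProd B w' = (wordProd B w)⁻¹ ∧ wordLen w' = wordLen w := by
  induction w with
  | nil => exact ⟨[], by simp, rfl⟩
  | cons x w ih =>
    obtain ⟨w', h, h'⟩ := ih
    exact ⟨w' ++ [-x], by simp [h, expH_inv], by simp [h', add_comm]⟩

theorem exists_wordProd_walk (y : ℕ → H) (n : ℕ) :
    ∃ w, wordProd B w = walk B y n ∧ wordLen w = ∑ k ∈ Finset.range n, ‖y k‖ := by
  induction n with
  | zero => exact ⟨[], rfl, rfl⟩
  | succ n ih =>
    obtain ⟨w, h, h'⟩ := ih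
    exact ⟨w ++ [y n], by simp [h, walk_succ], by simp [h', Finset.sum_range_succ]⟩

theorem exists_mul_eq_abs_eq_sqrt (c : ℝ) : ∃ a t : ℝ, a * t = c ∧ |a| = √|c| ∧ |t| = √|c| := by
  rcases le_total 0 c with h | h
  · refine ⟨√c, √c, Real.mul_self_sqrt h, ?_⟩
    simp [abs_of_nonneg h, abs_of_nonneg (Real.sqrt_nonneg c)]
  · refine ⟨√(-c), -√(-c), ?_, ?_⟩
    · have := Real.mul_self_sqrt (neg_nonneg.2 h)
      linarith
    · simp [abs_of_nonpos h, abs_of_nonneg (Real.sqrt_nonneg (-c))]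

/-- In step two the group commutator of `expH (a • x)` and `expH (t • y)` is exactly the vertical
element `(a t) • B.br x y`. Splitting `c = a t` into factors of equal size makes the length
proportional to `√|c|`. -/
theorem exists_wordProd_smul_br (c : ℝ) (x y : H) :
    ∃ w, wordProd B w = mk 0 (c • B.br x y) ∧ wordLen w = 2 * √|c| * (‖x‖ + ‖y‖) := by
  obtain ⟨a, t, hat, ha, ht⟩ := exists_mul_eq_abs_eq_sqrt c
  refine ⟨[a • x, t • y, -(a • x), -(t • y)], ?_, ?_⟩
  · apply ext_coord
    · simp
    · simp only [wordProd_cons, wordProd_nil, ver_mul, ver_expH, hor_mul, hor_expH, hor_one,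
        ver_one, map_add, map_neg, map_smul, LinearMap.smul_apply, LinearMap.neg_apply, B.br_self, br_swap x y, ver_mk,
        ← hat, map_zero]
      module
  · simp only [wordLen_cons, wordLen_nil, norm_neg, norm_smul, Real.norm_eq_abs, ha, ht]
    ring

/-- Brackets span `V`, so some basis consists of brackets. Each coordinate of `v` is realized by one
commutator word, and products of vertical elements add their coordinates. -/
theorem exists_wordProd_vertical [FiniteDimensional ℝ V] (B : StepTwoBracket H V) :
    ∃ C : ℝ, 0 ≤ C ∧ ∀ v : V, ∃ w, wordProd B w = mk 0 v ∧ wordLen w ≤ C * √‖v‖ := by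
  have hs : ⊤ ≤ Submodule.span ℝ {v | ∃ x y, B.br x y = v} := B.span_br.ge
  let b := Module.Basis.ofSpan hs
  have hb : ∀ i, ∃ x y, B.br x y = b i := fun i =>
    Module.Basis.ofSpan_subset hs (mem_range_self i)
  choose x y hxy using hb
  have : Fintype _ := FiniteDimensional.fintypeBasisIndex b
  let φ := fun i => LinearMap.toContinuousLinearMap (b.coord i)
  refine ⟨∑ i, 2 * √‖φ i‖ * (‖x i‖ + ‖y i‖), by positivity, fun v => ?_⟩
  have key : ∀ s : Finset _, ∃ w, wordProd B w = mk 0 (∑ i ∈ s, b.repr v i • b i) ∧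
      wordLen w ≤ ∑ i ∈ s, 2 * √‖φ i‖ * (‖x i‖ + ‖y i‖) * √‖v‖ := by
    classical
    intro s
    induction s using Finset.induction_on with
    | empty => exact ⟨[], by simp [mk_zero_zero], by simp⟩
    | insert i s hi ih =>
      obtain ⟨w, hw, hw'⟩ := ih
      obtain ⟨w₁, h₁, h₁'⟩ := exists_wordProd_smul_br (B := B) (b.repr v i) (x i) (y i)
      refine ⟨w₁ ++ w, ?_, ?_⟩
      · rw [wordProd_append, h₁, hw, mk_zero_mul_mk_zero, Finset.sum_insert hi, hxy]
      · rw [wordLen_append, h₁', Finset.sum_insert hi]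
        refine add_le_add ?_ hw'
        have : |b.repr v i| ≤ ‖φ i‖ * ‖v‖ := (φ i).le_opNorm v
        have h2 : √|b.repr v i| ≤ √‖φ i‖ * √‖v‖ := by
          rw [← Real.sqrt_mul (norm_nonneg _)]
          exact Real.sqrt_le_sqrt this
        calc 2 * √|b.repr v i| * (‖x i‖ + ‖y i‖)
            ≤ 2 * (√‖φ i‖ * √‖v‖) * (‖x i‖ + ‖y i‖) := by gcongr
          _ = _ := by ring
  obtain ⟨w, hw, hw'⟩ := key Finset.univ
  exact ⟨w, by rw [hw, b.sum_repr], by rwa [Finset.sum_mul]⟩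

/-- The infimum of the lengths of the words that represent a group element. -/
def wordNorm (x : CarnotGroup B) : ℝ := sInf (wordLen '' {w | wordProd B w = x})

theorem wordNorm_le (w : List H) : wordNorm (wordProd B w) ≤ wordLen w :=
  csInf_le ⟨0, by rintro _ ⟨w, -, rfl⟩; exact wordLen_nonneg w⟩ ⟨w, rfl, rfl⟩

theorem wordNorm_nonneg (x : CarnotGroup B) : 0 ≤ wordNorm x :=
  Real.sInf_nonneg (by rintro _ ⟨w, -, rfl⟩; exact wordLen_nonneg w)

/-- This rules out the infimum over the empty set, to which `sInf` would give the value `0`. -/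
theorem exists_wordProd_eq [FiniteDimensional ℝ V] (x : CarnotGroup B) :
    ∃ w, wordProd B w = x := by
  obtain ⟨C, -, h⟩ := exists_wordProd_vertical B
  obtain ⟨w, hw, -⟩ := h (ver x)
  exact ⟨hor x :: w, by rw [wordProd_cons, hw, ← eq_expH_mul_mk]⟩

variable [FiniteDimensional ℝ V]

theorem exists_wordLen_lt {x : CarnotGroup B} {r : ℝ} (h : wordNorm x < r) :
    ∃ w, wordProd B w = x ∧ wordLen w < r := by
  obtain ⟨_, ⟨w, hw, rfl⟩, h'⟩ := exists_lt_of_csInf_lt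
    (Set.Nonempty.image _ (exists_wordProd_eq x)) h
  exact ⟨w, hw, h'⟩

theorem wordNorm_mul_le (x y : CarnotGroup B) : wordNorm (x * y) ≤ wordNorm x + wordNorm y := by
  refine le_of_forall_pos_le_add fun ε hε => ?_
  obtain ⟨w, rfl, hw⟩ := exists_wordLen_lt (lt_add_of_pos_right (wordNorm x) (half_pos hε))
  obtain ⟨w', rfl, hw'⟩ := exists_wordLen_lt (lt_add_of_pos_right (wordNorm y) (half_pos hε))
  have := wordNorm_le (B := B) (w ++ w')
  rw [wordProd_append, wordLen_append] at this
  linarith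

theorem wordNorm_inv_le (x : CarnotGroup B) : wordNorm x⁻¹ ≤ wordNorm x := by
  refine le_of_forall_pos_le_add fun ε hε => ?_
  obtain ⟨w, rfl, hw⟩ := exists_wordLen_lt (lt_add_of_pos_right (wordNorm x) hε)
  obtain ⟨w', h, h'⟩ := exists_wordProd_inv (B := B) w
  rw [← h]
  exact (wordNorm_le w').trans (h'.trans_le hw.le)

theorem wordNorm_walk_le (y : ℕ → H) (n : ℕ) :
    wordNorm (walk B y n) ≤ ∑ k ∈ Finset.range n, ‖y k‖ := by
  obtain ⟨w, h, h'⟩ := exists_wordProd_walk (B := B) y n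
  rw [← h, ← h']
  exact wordNorm_le w

theorem exists_wordNorm_le (B : StepTwoBracket H V) :
    ∃ C : ℝ, 0 ≤ C ∧ ∀ x : CarnotGroup B, ∀ v : V,
      wordNorm (x * mk 0 v) ≤ wordNorm x + C * √‖v‖ := by
  obtain ⟨C, hC, h⟩ := exists_wordProd_vertical B
  refine ⟨C, hC, fun x v => ?_⟩
  obtain ⟨w, hw, hw'⟩ := h v
  refine (wordNorm_mul_le _ _).trans (add_le_add le_rfl ?_)
  rw [← hw]
  exact (wordNorm_le w).trans hw'

theorem wordNorm_expH_le (h : H) : wordNorm (expH h : CarnotGroup B) ≤ ‖h‖ := by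
  simpa using wordNorm_le (B := B) [h]

variable [FiniteDimensional ℝ H]

/-- The bracket as a continuous bilinear map. -/
def brL (B : StepTwoBracket H V) : H →L[ℝ] H →L[ℝ] V :=
  LinearMap.toContinuousLinearMap (LinearMap.toContinuousLinearMap.toLinearMap ∘ₗ B.br)

@[simp] theorem brL_apply (x y : H) : brL B x y = B.br x y := rfl

theorem norm_br_le (x y : H) : ‖B.br x y‖ ≤ ‖brL B‖ * ‖x‖ * ‖y‖ :=
  (brL B).le_opNorm₂ x y

instance : FiniteDimensional ℝ (CarnotGroup B) := inferInstanceAs (FiniteDimensional ℝ (H × V))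

theorem continuous_hor : Continuous (hor : CarnotGroup B → H) := continuous_fst

theorem continuous_ver : Continuous (ver : CarnotGroup B → V) := continuous_snd

theorem continuous_of_coord {T : Type*} [TopologicalSpace T] {f : T → CarnotGroup B}
    (hf : Continuous fun t => hor (f t)) (hg : Continuous fun t => ver (f t)) : Continuous f :=
  hf.prodMk hg

theorem continuous_br {T : Type*} [TopologicalSpace T] {f g : T → H} (hf : Continuous f)
    (hg : Continuous g) : Continuous fun t => B.br (f t) (g t) := by
  simp only [← brL_apply]
  fun_prop

end CarnotGroup

/-! ### The Maurer–Cartan form and homogeneously Lipschitz paths -/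

namespace CarnotGroup

variable {H V : Type*} [NormedAddCommGroup H] [InnerProductSpace ℝ H]
  [NormedAddCommGroup V] [NormedSpace ℝ V] {B : StepTwoBracket H V}
  [FiniteDimensional ℝ V] [FiniteDimensional ℝ H]

theorem norm_eq_max (x : CarnotGroup B) : ‖x‖ = max ‖hor x‖ ‖ver x‖ := rfl

/-- The horizontal projection as a continuous linear map. -/
def horL (B : StepTwoBracket H V) : CarnotGroup B →L[ℝ] H := LinearMap.toContinuousLinearMap hor

/-- The vertical projection as a continuous linear map. -/
def verL (B : StepTwoBracket H V) : CarnotGroup B →L[ℝ] V := LinearMap.toContinuousLinearMap ver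

@[simp] theorem verL_apply (x : CarnotGroup B) : verL B x = ver x := rfl

/-- The linear part of the left translation by `g`. -/
def leftMulL (g : CarnotGroup B) : CarnotGroup B →L[ℝ] CarnotGroup B :=
  LinearMap.toContinuousLinearMap
    { toFun := fun y => y + (1 / 2 : ℝ) • ⁅g, y⁆
      map_add' := fun y z => by rw [lie_add]; module
      map_smul' := fun c y => by rw [lie_smul]; simp only [RingHom.id_apply]; module }

theorem leftMulL_apply (g y : CarnotGroup B) : leftMulL g y = y + (1 / 2 : ℝ) • ⁅g, y⁆ := rfl

theorem mul_eq_add_leftMulL (g y : CarnotGroup B) : g * y = g + leftMulL g y := by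
  rw [mul_def, leftMulL_apply, add_assoc]

/-- Left translations are affine in these coordinates, so their derivative is the constant linear
part. -/
theorem maurerCartan_eq (γ : ℝ → CarnotGroup B) (t : ℝ) :
    maurerCartan γ t = leftMulL (γ t)⁻¹ (deriv γ t) := by
  have : (fun y : CarnotGroup B => (γ t)⁻¹ * y) = fun y => (γ t)⁻¹ + leftMulL (γ t)⁻¹ y :=
    funext fun y => mul_eq_add_leftMulL _ _
  rw [maurerCartan, this, fderiv_const_add, ContinuousLinearMap.fderiv]

@[simp] theorem hor_maurerCartan (γ : ℝ → CarnotGroup B) (t : ℝ) :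
    hor (maurerCartan γ t) = hor (deriv γ t) := by
  simp [maurerCartan_eq, leftMulL_apply]

@[simp] theorem ver_maurerCartan (γ : ℝ → CarnotGroup B) (t : ℝ) :
    ver (maurerCartan γ t) =
      ver (deriv γ t) - (1 / 2 : ℝ) • B.br (hor (γ t)) (hor (deriv γ t)) := by
  simp [maurerCartan_eq, leftMulL_apply, sub_eq_add_neg]

/-- Lipschitz continuity with respect to the homogeneous structure of the group. -/
def HomLip (K C : ℝ) (γ : ℝ → CarnotGroup B) : Prop :=
  ∀ s t, s ≤ t → ‖hor ((γ s)⁻¹ * γ t)‖ ≤ K * (t - s) ∧ ‖ver ((γ s)⁻¹ * γ t)‖ ≤ C * (t - s) ^ 2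

theorem HomLip.const_mul {K C : ℝ} {γ : ℝ → CarnotGroup B} (h : HomLip K C γ)
    (g : CarnotGroup B) : HomLip K C fun t => g * γ t := by
  intro s t hst
  simpa [mul_assoc] using h s t hst

theorem HomLip.comp_affine {K C : ℝ} {γ : ℝ → CarnotGroup B} (h : HomLip K C γ) {a : ℝ}
    (ha : 0 ≤ a) (b : ℝ) : HomLip (K * a) (C * a ^ 2) fun t => γ (a * t + b) := by
  intro s t hst
  have h' := h (a * s + b) (a * t + b) (by gcongr)
  rw [show a * t + b - (a * s + b) = a * (t - s) by ring] at h'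
  exact ⟨h'.1.trans_eq (by ring), h'.2.trans_eq (by ring)⟩

/-- Across the junction the vertical increment gains a bracket of size at most `‖brL B‖ K² (T - s)
(t - T) / 2`. The condition `hC` lets the cross term `2 C (T - s) (t - T)` of `C (t - s)²` absorb
it, so the constants survive any number of gluings. -/
theorem HomLip.glue {K C T : ℝ} {p q : ℝ → CarnotGroup B} (hp : HomLip K C p)
    (hq : HomLip K C q) (hT : p T = q T) (hC : ‖brL B‖ * K ^ 2 ≤ 4 * C) :
    HomLip K C fun t => if t ≤ T then p t else q t := by
  intro s t hst
  rcases le_or_gt t T with ht | ht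
  · simpa [ht, hst.trans ht] using hp s t hst
  rcases le_or_gt s T with hs | hs
  swap
  · simpa [hs.not_ge, ht.not_ge] using hq s t hst
  simp only [hs, ht.not_ge, if_true, if_false]
  have e : (p s)⁻¹ * q t = ((p s)⁻¹ * p T) * ((q T)⁻¹ * q t) := by rw [hT]; group
  obtain ⟨h1, h1'⟩ := hp s T hs
  obtain ⟨h2, h2'⟩ := hq T t ht.le
  rw [e, hor_mul, ver_mul]
  refine ⟨(norm_add_le _ _).trans (by linarith), ?_⟩
  have hb : ‖(1 / 2 : ℝ) • B.br (hor ((p s)⁻¹ * p T)) (hor ((q T)⁻¹ * q t))‖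
      ≤ 1 / 2 * (‖brL B‖ * (K * (T - s)) * (K * (t - T))) := by
    rw [norm_smul, Real.norm_of_nonneg (by norm_num)]
    refine mul_le_mul_of_nonneg_left ((norm_br_le _ _).trans ?_) (by norm_num)
    have := (norm_nonneg _).trans h1
    gcongr
  refine (norm_add₃_le).trans ((add_le_add (add_le_add h1' h2') hb).trans ?_)
  have : 0 ≤ (T - s) * (t - T) := mul_nonneg (by linarith) (by linarith)
  nlinarith [mul_le_mul_of_nonneg_right hC this]

theorem homLip_line (x : H) (C : ℝ) (hC : 0 ≤ C) :
    HomLip 1 C fun t => (expH ((t / ‖x‖) • x) : CarnotGroup B) := by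
  intro s t hst
  constructor
  · simp only [hor_mul, hor_inv, hor_expH]
    rw [neg_add_eq_sub, ← sub_smul, norm_smul, ← sub_div, norm_div, norm_norm,
      Real.norm_of_nonneg (sub_nonneg.2 hst), one_mul]
    rcases eq_or_ne ‖x‖ 0 with hx | hx
    · simpa [hx] using hst
    · rw [div_mul_cancel₀ _ hx]
  · simp only [ver_mul, hor_inv, ver_inv, hor_expH, ver_expH, map_neg, map_smul,
      LinearMap.neg_apply, LinearMap.smul_apply, B.br_self]
    simp only [smul_zero, neg_zero, add_zero, norm_zero]
    positivity

theorem exists_homLip_of_word (w : List H) :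
    ∃ γ : ℝ → CarnotGroup B, HomLip 1 ‖brL B‖ γ ∧ γ 0 = 1 ∧ γ (wordLen w) = wordProd B w := by
  induction w with
  | nil => exact ⟨fun _ => 1, fun s t hst => by simp [hst]; positivity, rfl, rfl⟩
  | cons x w ih =>
    obtain ⟨q, hq, hq0, hq1⟩ := ih
    have hx : (‖x‖ / ‖x‖) • x = x := by
      rcases eq_or_ne x 0 with rfl | hx
      · simp
      · rw [div_self (norm_ne_zero_iff.2 hx), one_smul]
    have hq' : HomLip 1 ‖brL B‖ fun t => expH x * q (t - ‖x‖) := by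
      simpa [sub_eq_add_neg] using (hq.comp_affine zero_le_one (-‖x‖)).const_mul (expH x)
    have hg := (homLip_line (B := B) x _ (norm_nonneg (brL B))).glue (T := ‖x‖) hq'
      (by simp [hx, hq0]) (by linarith [norm_nonneg (brL B)])
    refine ⟨_, hg, by simp [expH_zero], ?_⟩
    have hw := wordLen_nonneg w
    -- If the remaining word has length zero, the final time is the junction itself, where the first
    -- branch of the glued path is in force.
    rcases hw.eq_or_lt with h0 | h0
    · have : wordLen (x :: w) = ‖x‖ := by rw [wordLen_cons, ← h0, add_zero]
      simp only [this, le_refl, if_true, hx, wordProd_cons, ← hq1, ← h0, hq0, mul_one]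
    · have : ¬ wordLen (x :: w) ≤ ‖x‖ := by rw [wordLen_cons]; linarith
      simp only [this, if_false]
      rw [wordLen_cons, wordProd_cons, add_sub_cancel_left, hq1]

/-- Two points are joined by a path of constant speed at most `r` if `r` exceeds the word norm of
their difference. -/
theorem exists_homLip_of_wordNorm_lt (x y : CarnotGroup B) {r : ℝ} (h : wordNorm (x⁻¹ * y) < r) :
    ∃ γ : ℝ → CarnotGroup B, ∃ C, HomLip r C γ ∧ γ 0 = x ∧ γ 1 = y := by
  obtain ⟨w, hw, hr⟩ := exists_wordLen_lt h
  obtain ⟨q, hq, hq0, hq1⟩ := exists_homLip_of_word (B := B) w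
  have h' := (hq.comp_affine (wordLen_nonneg w) 0).const_mul x
  refine ⟨_, _, fun s t hst => ⟨(h' s t hst).1.trans ?_, (h' s t hst).2⟩, by simp [hq0],
    by simp [hq1, hw]⟩
  rw [one_mul]
  exact mul_le_mul_of_nonneg_right hr.le (sub_nonneg.2 hst)

namespace HomLip

variable {K C : ℝ} {γ : ℝ → CarnotGroup B}

theorem norm_hor_sub_le (h : HomLip K C γ) (s t : ℝ) :
    ‖hor (γ t) - hor (γ s)‖ ≤ K * |t - s| := by
  rcases le_total s t with hst | hst
  · simpa [abs_of_nonneg (sub_nonneg.2 hst), neg_add_eq_sub] using (h s t hst).1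
  · rw [norm_sub_rev, abs_sub_comm]
    simpa [abs_of_nonneg (sub_nonneg.2 hst), neg_add_eq_sub] using (h t s hst).1

theorem norm_ver_le (h : HomLip K C γ) (s t : ℝ) :
    ‖ver ((γ s)⁻¹ * γ t)‖ ≤ C * (t - s) ^ 2 := by
  rcases le_total s t with hst | hst
  · exact (h s t hst).2
  · rw [← norm_neg, ← ver_inv, show ((γ s)⁻¹ * γ t)⁻¹ = (γ t)⁻¹ * γ s by group, ← neg_sq, neg_sub]
    exact (h t s hst).2

theorem nonneg_left (h : HomLip K C γ) : 0 ≤ K := by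
  simpa using (norm_nonneg _).trans (h 0 1 zero_le_one).1

theorem nonneg_right (h : HomLip K C γ) : 0 ≤ C := by
  simpa using (norm_nonneg _).trans (h 0 1 zero_le_one).2

theorem norm_hor_deriv_le (h : HomLip K C γ) (t : ℝ) : ‖hor (deriv γ t)‖ ≤ K := by
  by_cases hd : DifferentiableAt ℝ γ t
  · have h1 : HasDerivAt (fun s => hor (γ s)) (hor (deriv γ t)) t :=
      (horL B).hasFDerivAt.comp_hasDerivAt t hd.hasDerivAt
    refine h1.le_of_lip' h.nonneg_left (Eventually.of_forall fun s => ?_)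
    simpa [Real.norm_eq_abs] using h.norm_hor_sub_le t s
  · simpa [deriv_zero_of_not_differentiableAt hd] using h.nonneg_left

/-- The vertical part of `(γ t)⁻¹ * γ s` is `O((s - t)²)`, so its derivative at `s = t` vanishes.
Where `γ` is not differentiable, `deriv` is `0` by convention. -/
theorem maurerCartan_mem (h : HomLip K C γ) (t : ℝ) : maurerCartan γ t ∈ layerOne B := by
  rw [maurerCartan_eq]
  by_cases hd : DifferentiableAt ℝ γ t
  swap
  · simp [deriv_zero_of_not_differentiableAt hd]
  have h1 : HasDerivAt (fun s => ver ((γ t)⁻¹ * γ s)) (ver (leftMulL (γ t)⁻¹ (deriv γ t))) t := by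
    have := ((verL B ∘L leftMulL (γ t)⁻¹).hasFDerivAt.comp_hasDerivAt t hd.hasDerivAt).const_add
      (ver (γ t)⁻¹)
    convert this using 2 with s
    · rw [mul_eq_add_leftMulL, map_add]
      rfl
    · rfl
  have h2 : HasDerivAt (fun s => ver ((γ t)⁻¹ * γ s)) 0 t := by
    rw [hasDerivAt_iff_isLittleO]
    have h3 : (fun s : ℝ => (s - t) ^ 2) =o[𝓝 t] fun s => s - t := by
      have : Tendsto (fun s : ℝ => s - t) (𝓝 t) (𝓝 0) := by
        have : Continuous fun s : ℝ => s - t := by fun_prop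
        simpa using this.tendsto t
      exact (Asymptotics.isLittleO_pow_id one_lt_two).comp_tendsto this
    refine Asymptotics.IsBigO.trans_isLittleO (Asymptotics.IsBigO.of_bound C ?_) h3
    refine Eventually.of_forall fun s => ?_
    simpa using h.norm_ver_le t s
  exact h1.unique h2

theorem absolutelyContinuousOnInterval (h : HomLip K C γ) :
    AbsolutelyContinuousOnInterval γ 0 1 := by
  have hK := h.nonneg_left
  have hC := h.nonneg_right
  set D : ℝ := K + C + ‖brL B‖ * (‖hor (γ 0)‖ + K) * K with hD
  refine LipschitzOnWith.absolutelyContinuousOnInterval (K := ⟨D, by positivity⟩) ?_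
  refine LipschitzOnWith.of_dist_le_mul fun t ht s hs => ?_
  rw [uIcc_of_le zero_le_one] at hs ht
  have h0 : ‖hor (γ s)‖ ≤ ‖hor (γ 0)‖ + K := by
    have h1 := h.norm_hor_sub_le 0 s
    rw [sub_zero, abs_of_nonneg hs.1] at h1
    have h2 := norm_le_insert' (hor (γ s)) (hor (γ 0))
    nlinarith [hs.2]
  have h1 := h.norm_hor_sub_le s t
  -- The Euclidean increment differs from the group increment by a bracket that is linear in the
  -- horizontal increment, with a coefficient bounded on `[0, 1]`.
  have e : ver (γ t) - ver (γ s) = ver ((γ s)⁻¹ * γ t)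
      + (1 / 2 : ℝ) • B.br (hor (γ s)) (hor (γ t) - hor (γ s)) := by
    simp only [ver_mul, ver_inv, hor_inv, map_neg, map_sub, LinearMap.neg_apply, B.br_self]
    module
  have ht1 : |t - s| ≤ 1 := abs_sub_le_iff.2 ⟨by linarith [ht.2, hs.1], by linarith [hs.2, ht.1]⟩
  have h2 : ‖ver (γ t) - ver (γ s)‖ ≤ C * |t - s| + ‖brL B‖ * (‖hor (γ 0)‖ + K) * (K * |t - s|) := by
    rw [e]
    refine (norm_add_le _ _).trans (add_le_add ((h.norm_ver_le s t).trans ?_) ?_)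
    · rw [← sq_abs]
      nlinarith [abs_nonneg (t - s), mul_le_mul_of_nonneg_left ht1 (abs_nonneg (t - s))]
    · rw [norm_smul, Real.norm_of_nonneg (by norm_num)]
      refine (mul_le_of_le_one_left (norm_nonneg _) (by norm_num)).trans ((norm_br_le _ _).trans ?_)
      gcongr
  rw [dist_eq_norm, norm_eq_max, map_sub, map_sub, Real.dist_eq]
  change _ ≤ D * |t - s|
  have h3 : 0 ≤ ‖brL B‖ * (‖hor (γ 0)‖ + K) * (K * |t - s|) := by positivity
  refine max_le ?_ ?_ <;> rw [hD] <;> nlinarith [mul_nonneg hC (abs_nonneg (t - s)),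
    mul_nonneg hK (abs_nonneg (t - s))]

theorem isHorizontal (h : HomLip K C γ) : IsHorizontal γ :=
  ⟨h.absolutelyContinuousOnInterval, Eventually.of_forall h.maurerCartan_mem⟩

theorem enorm_hor_maurerCartan_le (h : HomLip K C γ) (t : ℝ) :
    ‖hor (maurerCartan γ t)‖ₑ ≤ ENNReal.ofReal K := by
  rw [hor_maurerCartan, ← ofReal_norm]
  exact ENNReal.ofReal_le_ofReal (h.norm_hor_deriv_le t)

theorem pathLength_le (h : HomLip K C γ) : pathLength γ ≤ ENNReal.ofReal K := by
  refine (setLIntegral_mono' measurableSet_Icc fun t _ => h.enorm_hor_maurerCartan_le t).trans ?_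
  simp

theorem energy_le (h : HomLip K C γ) : energy γ ≤ ENNReal.ofReal K ^ 2 := by
  refine (setLIntegral_mono' measurableSet_Icc fun t _ =>
    pow_le_pow_left' (h.enorm_hor_maurerCartan_le t) 2).trans ?_
  simp

end HomLip

end CarnotGroup

/-! ### Absolutely continuous vector-valued functions -/

theorem deriv_const_clm_comp {E F : Type*} [NormedAddCommGroup E] [NormedSpace ℝ E]
    [NormedAddCommGroup F] [NormedSpace ℝ F] (L : E →L[ℝ] F) {f : ℝ → E} {t : ℝ}
    (h : DifferentiableAt ℝ f t) : deriv (fun t => L (f t)) t = L (deriv f t) :=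
  (L.hasFDerivAt.comp_hasDerivAt t h.hasDerivAt).deriv

namespace AbsolutelyContinuousOnInterval

theorem clm_comp {E F : Type*} [NormedAddCommGroup E] [NormedSpace ℝ E] [NormedAddCommGroup F]
    [NormedSpace ℝ F] {f : ℝ → E} {a b : ℝ} (hf : AbsolutelyContinuousOnInterval f a b)
    (L : E →L[ℝ] F) : AbsolutelyContinuousOnInterval (fun t => L (f t)) a b := by
  refine squeeze_zero (fun t => Finset.sum_nonneg fun i _ => dist_nonneg) (fun t => ?_)
    (by simpa using Tendsto.const_mul ‖L‖ hf)
  rw [Finset.mul_sum]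
  exact Finset.sum_le_sum fun i _ => L.dist_le_opNorm _ _

theorem ae_differentiableAt_of_finiteDimensional {F : Type*} [NormedAddCommGroup F]
    [NormedSpace ℝ F] [FiniteDimensional ℝ F] {f : ℝ → F} {a b : ℝ}
    (hf : AbsolutelyContinuousOnInterval f a b) :
    ∀ᵐ t, t ∈ uIcc a b → DifferentiableAt ℝ f t :=
  hf.boundedVariationOn.ae_differentiableAt_of_mem_uIcc

/-- The mean value inequality for absolutely continuous functions. -/
theorem norm_sub_le_integral {F : Type*} [NormedAddCommGroup F] [NormedSpace ℝ F]
    [FiniteDimensional ℝ F] {f : ℝ → F} {a b : ℝ} (hab : a ≤ b)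
    (hf : AbsolutelyContinuousOnInterval f a b) {g : ℝ → ℝ} (hg : IntervalIntegrable g volume a b)
    (h : ∀ᵐ t, t ∈ uIcc a b → DifferentiableAt ℝ f t → ‖deriv f t‖ ≤ g t) :
    ‖f b - f a‖ ≤ ∫ t in a..b, g t := by
  -- A norming functional of the increment reduces the claim to the scalar fundamental theorem of
  -- calculus.
  obtain ⟨φ, hφ, hφ'⟩ := exists_dual_vector'' ℝ (f b - f a)
  have hac := hf.clm_comp φ
  have h1 : ∫ t in a..b, deriv (fun t => φ (f t)) t = ‖f b - f a‖ := by
    rw [hac.integral_deriv_eq_sub, ← map_sub, hφ']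
    rfl
  rw [← h1]
  refine intervalIntegral.integral_mono_ae_restrict hab hac.intervalIntegrable_deriv hg ?_
  rw [EventuallyLE, ae_restrict_iff' measurableSet_Icc]
  filter_upwards [h, hf.ae_differentiableAt_of_finiteDimensional] with t ht hd htI
  rw [← uIcc_of_le hab] at htI
  rw [deriv_const_clm_comp φ (hd htI)]
  refine (le_abs_self _).trans ((φ.le_opNorm _).trans ?_)
  exact (mul_le_of_le_one_left (norm_nonneg _) hφ).trans (ht htI (hd htI))

end AbsolutelyContinuousOnInterval

/-! ### The Carnot–Carathéodory distance equals the word norm -/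

namespace CarnotGroup

variable {H V : Type*} [NormedAddCommGroup H] [InnerProductSpace ℝ H]
  [NormedAddCommGroup V] [NormedSpace ℝ V] {B : StepTwoBracket H V}
  [FiniteDimensional ℝ V] [FiniteDimensional ℝ H]

/-- The speed of a path. -/
def speed (γ : ℝ → CarnotGroup B) (t : ℝ) : ℝ := ‖hor (deriv γ t)‖

theorem speed_nonneg (γ : ℝ → CarnotGroup B) (t : ℝ) : 0 ≤ speed γ t := norm_nonneg _

theorem measurable_speed (γ : ℝ → CarnotGroup B) : Measurable (speed γ) := by
  have : CompleteSpace (CarnotGroup B) := FiniteDimensional.complete ℝ _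
  exact (continuous_norm.comp continuous_hor).measurable.comp (measurable_deriv γ)

theorem enorm_hor_maurerCartan (γ : ℝ → CarnotGroup B) (t : ℝ) :
    ‖hor (maurerCartan γ t)‖ₑ = ENNReal.ofReal (speed γ t) := by
  rw [hor_maurerCartan, speed, ofReal_norm]

theorem intervalIntegrable_speed {γ : ℝ → CarnotGroup B} (h : pathLength γ ≠ ∞) :
    IntervalIntegrable (speed γ) volume 0 1 := by
  rw [intervalIntegrable_iff_integrableOn_Icc_of_le zero_le_one]
  refine ⟨(measurable_speed γ).aestronglyMeasurable, ?_⟩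
  rw [hasFiniteIntegral_iff_ofReal (Eventually.of_forall (speed_nonneg γ))]
  simpa only [pathLength, enorm_hor_maurerCartan] using h.lt_top

theorem ofReal_integral_speed {γ : ℝ → CarnotGroup B} (h : pathLength γ ≠ ∞) :
    ENNReal.ofReal (∫ t in (0 : ℝ)..1, speed γ t) = pathLength γ := by
  rw [intervalIntegral.integral_of_le zero_le_one, ← integral_Icc_eq_integral_Ioc,
    ofReal_integral_eq_lintegral_ofReal
      ((intervalIntegrable_iff_integrableOn_Icc_of_le zero_le_one).1 (intervalIntegrable_speed h))
      (Eventually.of_forall (speed_nonneg γ))]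
  simp only [pathLength, enorm_hor_maurerCartan]

/-- After translating `γ s` to the identity, horizontality makes the vertical velocity half the
bracket of `hor (γ u) - hor (γ s)` with `hor (deriv γ u)`. The first entry is bounded by the length
of the piece, and integrating the second produces another factor of that length. -/
theorem IsHorizontal.increment_le {γ : ℝ → CarnotGroup B} (h : IsHorizontal γ)
    (hL : pathLength γ ≠ ∞) {s t : ℝ} (hs : 0 ≤ s) (hst : s ≤ t) (ht : t ≤ 1) :
    ‖hor ((γ s)⁻¹ * γ t)‖ ≤ ∫ u in s..t, speed γ u ∧
      ‖ver ((γ s)⁻¹ * γ t)‖ ≤ ‖brL B‖ * (∫ u in s..t, speed γ u) ^ 2 := by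
  have hint : ∀ {a b : ℝ}, 0 ≤ a → a ≤ b → b ≤ 1 → IntervalIntegrable (speed γ) volume a b :=
    fun ha hab hb => (intervalIntegrable_speed hL).mono_set (by
      rw [uIcc_of_le hab, uIcc_of_le zero_le_one]
      exact Icc_subset_Icc ha hb)
  have hac : ∀ {a b : ℝ}, 0 ≤ a → a ≤ b → b ≤ 1 → AbsolutelyContinuousOnInterval γ a b :=
    fun ha hab hb => h.1.mono (by
      rw [uIcc_of_le hab, uIcc_of_le zero_le_one]
      exact Icc_subset_Icc ha hb)
  have hor_le : ∀ {a b : ℝ}, 0 ≤ a → a ≤ b → b ≤ 1 →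
      ‖hor (γ b) - hor (γ a)‖ ≤ ∫ u in a..b, speed γ u := by
    intro a b ha hab hb
    refine ((hac ha hab hb).clm_comp (horL B)).norm_sub_le_integral hab (hint ha hab hb) ?_
    filter_upwards [(hac ha hab hb).ae_differentiableAt_of_finiteDimensional] with u hu huI _
    rw [deriv_const_clm_comp (horL B) (hu huI)]
    exact le_rfl
  refine ⟨by simpa [neg_add_eq_sub] using hor_le hs hst ht, ?_⟩
  set ℓ := ∫ u in s..t, speed γ u with hℓ
  have hv := ((hac hs hst ht).clm_comp (verL B ∘L leftMulL (γ s)⁻¹)).norm_sub_le_integral hst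
    (g := fun u => ‖brL B‖ * ℓ * speed γ u) ((hint hs hst ht).const_mul _) ?_
  · rw [intervalIntegral.integral_const_mul, ← hℓ] at hv
    refine le_trans (le_of_eq ?_) (hv.trans_eq (by ring))
    rw [mul_eq_add_leftMulL]
    simp only [ContinuousLinearMap.comp_apply, verL_apply, leftMulL_apply, map_add, ver_inv,
      map_smul, ver_bracket, hor_inv, map_neg, LinearMap.neg_apply, B.br_self]
    congr 1
    module
  · have hmc := (ae_restrict_iff' measurableSet_Icc).1 h.2
    filter_upwards [(hac hs hst ht).ae_differentiableAt_of_finiteDimensional, hmc]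
      with u hu hmu huI _
    have huI' := huI
    rw [uIcc_of_le hst] at huI'
    have hver : ver (deriv γ u) = (1 / 2 : ℝ) • B.br (hor (γ u)) (hor (deriv γ u)) := by
      have : ver (maurerCartan γ u) = 0 := hmu ⟨hs.trans huI'.1, huI'.2.trans ht⟩
      rwa [ver_maurerCartan, sub_eq_zero] at this
    rw [deriv_const_clm_comp (verL B ∘L leftMulL (γ s)⁻¹) (hu huI)]
    have e : (verL B ∘L leftMulL (γ s)⁻¹) (deriv γ u)
        = (1 / 2 : ℝ) • B.br (hor (γ u) - hor (γ s)) (hor (deriv γ u)) := by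
      simp only [ContinuousLinearMap.comp_apply, verL_apply, leftMulL_apply, map_add, hver,
        map_smul, ver_bracket, hor_inv, map_neg, LinearMap.neg_apply, map_sub, LinearMap.sub_apply]
      module
    rw [e, norm_smul, Real.norm_of_nonneg (by norm_num)]
    refine (mul_le_of_le_one_left (norm_nonneg _) (by norm_num)).trans ((norm_br_le _ _).trans ?_)
    have h1 : ‖hor (γ u) - hor (γ s)‖ ≤ ℓ := by
      refine (hor_le hs huI'.1 (huI'.2.trans ht)).trans ?_
      rw [hℓ, ← intervalIntegral.integral_add_adjacent_intervals
        (hint hs huI'.1 (huI'.2.trans ht)) (hint (hs.trans huI'.1) huI'.2 ht)]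
      exact le_add_of_nonneg_right
        (intervalIntegral.integral_nonneg huI'.2 fun _ _ => speed_nonneg _ _)
    change _ ≤ ‖brL B‖ * ℓ * ‖hor (deriv γ u)‖
    gcongr

/-- A sequence of points whose increments are almost horizontal. -/
theorem wordNorm_inv_mul_le {C : ℝ} (hC0 : 0 ≤ C)
    (hC : ∀ x : CarnotGroup B, ∀ v, wordNorm (x * mk 0 v) ≤ wordNorm x + C * √‖v‖)
    (g : ℕ → CarnotGroup B) (n : ℕ) :
    wordNorm ((g 0)⁻¹ * g n) ≤ ∑ k ∈ Finset.range n, ‖hor ((g k)⁻¹ * g (k + 1))‖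
      + C * √(∑ k ∈ Finset.range n, ‖ver ((g k)⁻¹ * g (k + 1))‖) := by
  rw [inv_mul_eq_walk_mul]
  refine (hC _ _).trans (add_le_add (wordNorm_walk_le _ _) ?_)
  gcongr
  exact norm_sum_le _ _

/-- With all pieces of length at most `ε`, the squares of their lengths sum to at most `ε L`, where
`L` is the total length. The vertical defect therefore costs only `C √(‖brL B‖ ε L)`, which tends to
`0`. -/
theorem IsHorizontal.ofReal_wordNorm_le {γ : ℝ → CarnotGroup B} (h : IsHorizontal γ) :
    ENNReal.ofReal (wordNorm ((γ 0)⁻¹ * γ 1)) ≤ pathLength γ := by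
  by_cases hL : pathLength γ = ∞
  · simp [hL]
  obtain ⟨C, hC0, hC⟩ := exists_wordNorm_le B
  rw [← ofReal_integral_speed hL]
  refine ENNReal.ofReal_le_ofReal ?_
  set L := ∫ t in (0 : ℝ)..1, speed γ t with hLdef
  have hint := intervalIntegrable_speed hL
  have hL0 : 0 ≤ L := intervalIntegral.integral_nonneg zero_le_one fun _ _ => speed_nonneg _ _
  have key : ∀ ε > 0, wordNorm ((γ 0)⁻¹ * γ 1) ≤ L + C * √(‖brL B‖ * (ε * L)) := by
    intro ε hε
    have hcont : UniformContinuousOn (fun t => ∫ u in (0 : ℝ)..t, speed γ u) (Icc 0 1) := by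
      refine isCompact_Icc.uniformContinuousOn_of_continuous ?_
      have := intervalIntegral.continuousOn_primitive_interval' hint left_mem_uIcc
      rwa [uIcc_of_le zero_le_one] at this
    obtain ⟨δ, hδ, hunif⟩ := Metric.uniformContinuousOn_iff.1 hcont ε hε
    obtain ⟨N, hN⟩ := exists_nat_one_div_lt hδ
    set n := N + 1 with hn
    have hn0 : (0 : ℝ) < n := by positivity
    have hmem : ∀ k : ℕ, k ≤ n → (k : ℝ) / n ∈ Icc (0 : ℝ) 1 := fun k hk =>
      ⟨by positivity, (div_le_one hn0).2 (by exact_mod_cast hk)⟩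
    let ℓ : ℕ → ℝ := fun k => ∫ u in ((k : ℝ) / n)..((k + 1 : ℕ) : ℝ) / n, speed γ u
    have hstep : ∀ k : ℕ, (k : ℝ) / n ≤ ((k + 1 : ℕ) : ℝ) / n := fun k => by gcongr; simp
    have hii : ∀ {a b : ℝ}, a ∈ Icc (0 : ℝ) 1 → b ∈ Icc (0 : ℝ) 1 →
        IntervalIntegrable (speed γ) volume a b := fun ha hb => hint.mono_set (by
      rw [uIcc_of_le (zero_le_one' ℝ)]
      exact uIcc_subset_Icc ha hb)
    have hℓε : ∀ k < n, ℓ k ≤ ε := by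
      intro k hk
      have h1 := hunif _ (hmem (k + 1) hk) _ (hmem k hk.le) (by
        rw [Real.dist_eq, ← sub_div]
        push_cast
        rw [add_sub_cancel_left, abs_of_pos (by positivity)]
        simpa [hn] using hN)
      have h2 : ℓ k = (∫ u in (0 : ℝ)..((k + 1 : ℕ) : ℝ) / n, speed γ u)
          - ∫ u in (0 : ℝ)..((k : ℝ) / n), speed γ u := by
        rw [intervalIntegral.integral_interval_sub_left
          (hii ⟨le_rfl, zero_le_one⟩ (hmem _ hk)) (hii ⟨le_rfl, zero_le_one⟩ (hmem _ hk.le))]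
      rw [h2]
      exact (le_abs_self _).trans h1.le
    have hℓ0 : ∀ k, 0 ≤ ℓ k := fun k =>
      intervalIntegral.integral_nonneg (hstep k) fun _ _ => speed_nonneg _ _
    have hsum : ∑ k ∈ Finset.range n, ℓ k = L := by
      have := intervalIntegral.sum_integral_adjacent_intervals (f := speed γ) (μ := volume)
        (a := fun k : ℕ => (k : ℝ) / n) (n := n) fun k hk => hii (hmem k hk.le) (hmem _ hk)
      simpa [ℓ, hLdef, div_self hn0.ne'] using this
    have hinc : ∀ k < n, _ := fun k hk =>
      h.increment_le hL (hmem k (le_of_lt hk)).1 (hstep k) (hmem (k + 1) hk).2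
    have hw := wordNorm_inv_mul_le hC0 hC (fun k : ℕ => γ ((k : ℝ) / n)) n
    simp only [Nat.cast_zero, zero_div, div_self hn0.ne'] at hw
    refine hw.trans (add_le_add ?_ ?_)
    · rw [← hsum]
      exact Finset.sum_le_sum fun k hk => (hinc k (Finset.mem_range.1 hk)).1
    · gcongr
      rw [← hsum, Finset.mul_sum, Finset.mul_sum]
      refine Finset.sum_le_sum fun k hk => (hinc k (Finset.mem_range.1 hk)).2.trans ?_
      rw [sq]
      have := hℓε k (Finset.mem_range.1 hk)
      have := hℓ0 k
      change ‖brL B‖ * (ℓ k * ℓ k) ≤ _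
      gcongr
  have hlim : Tendsto (fun ε : ℝ => L + C * √(‖brL B‖ * (ε * L))) (𝓝[>] 0) (𝓝 L) := by
    have : Continuous fun ε : ℝ => L + C * √(‖brL B‖ * (ε * L)) := by fun_prop
    have := this.tendsto 0
    simp only [zero_mul, mul_zero, Real.sqrt_zero, add_zero] at this
    exact this.mono_left nhdsWithin_le_nhds
  exact ge_of_tendsto hlim (eventually_mem_nhdsWithin.mono fun ε hε => key ε hε)

theorem rhoCC_eq (x y : CarnotGroup B) : rhoCC x y = ENNReal.ofReal (wordNorm (x⁻¹ * y)) := by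
  refine le_antisymm ?_ ?_
  · refine ENNReal.le_of_forall_pos_le_add fun ε hε _ => ?_
    obtain ⟨γ, C, hγ, h0, h1⟩ := exists_homLip_of_wordNorm_lt x y
      (lt_add_of_pos_right (wordNorm (x⁻¹ * y)) (NNReal.coe_pos.2 hε))
    refine (iInf₂_le γ ⟨hγ.isHorizontal, h0, h1⟩).trans (hγ.pathLength_le.trans ?_)
    rw [ENNReal.ofReal_add (wordNorm_nonneg _) ε.coe_nonneg, ENNReal.ofReal_coe_nnreal]
  · refine le_iInf₂ fun γ hγ => ?_
    obtain ⟨h, rfl, rfl⟩ := hγ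
    exact h.ofReal_wordNorm_le

theorem dCC_eq (x : CarnotGroup B) : dCC x = ENNReal.ofReal (wordNorm x) := by
  rw [dCC, rhoCC_eq, inv_one, one_mul]

theorem pathLength_sq_le_energy (γ : ℝ → CarnotGroup B) : pathLength γ ^ 2 ≤ energy γ := by
  have hm : Measurable fun t => ‖hor (maurerCartan γ t)‖ₑ := by
    simp only [enorm_hor_maurerCartan]
    exact (measurable_speed γ).ennreal_ofReal
  have h := ENNReal.lintegral_mul_le_Lp_mul_Lq (volume.restrict (Icc (0 : ℝ) 1))
    Real.HolderConjugate.two_two hm.aemeasurable (aemeasurable_const (b := (1 : ℝ≥0∞)))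
  simp only [Pi.mul_apply, mul_one, ENNReal.one_rpow, lintegral_const, Measure.restrict_apply_univ,
    Real.volume_Icc, sub_zero, ENNReal.ofReal_one] at h
  calc pathLength γ ^ 2 ≤ (energy γ ^ (1 / 2 : ℝ)) ^ 2 := by
        refine pow_le_pow_left' ?_ 2
        simpa [pathLength, energy] using h
    _ = energy γ := by
        rw [← ENNReal.rpow_natCast, ← ENNReal.rpow_mul]
        norm_num

/-- For `≤`, any `r > wordNorm x` admits a path of speed at most `r`, hence of energy at most `r²`.
The other direction is Cauchy–Schwarz on an interval of length one. -/
theorem iInf_energy_eq (x : CarnotGroup B) :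
    ⨅ γ ∈ horizontalPaths 1 x, energy γ / 2 = dCC x ^ 2 / 2 := by
  refine le_antisymm ?_ ?_
  · have hlim : Tendsto (fun r : ℝ => ENNReal.ofReal r ^ 2 / 2) (𝓝[>] (wordNorm x))
        (𝓝 (dCC x ^ 2 / 2)) := by
      rw [dCC_eq]
      refine Tendsto.mono_left ?_ nhdsWithin_le_nhds
      exact ENNReal.Tendsto.div_const
        (ENNReal.Tendsto.pow (ENNReal.continuous_ofReal.tendsto _)) (Or.inr two_ne_zero)
    refine ge_of_tendsto hlim (eventually_mem_nhdsWithin.mono fun r hr => ?_)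
    obtain ⟨γ, C, hγ, h0, h1⟩ := exists_homLip_of_wordNorm_lt 1 x (r := r) (by simpa using hr)
    exact (iInf₂_le γ ⟨hγ.isHorizontal, h0, h1⟩).trans (ENNReal.div_le_div_right hγ.energy_le 2)
  · refine le_iInf₂ fun γ hγ => ENNReal.div_le_div_right ?_ 2
    refine le_trans (pow_le_pow_left' ?_ 2) (pathLength_sq_le_energy γ)
    exact iInf₂_le γ hγ

end CarnotGroup

/-! ## Standard Gaussian measures -/

theorem lintegral_pi_prod {ι : Type*} [Fintype ι] {α : ι → Type*} [∀ i, MeasurableSpace (α i)]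
    (μ : ∀ i, Measure (α i)) [∀ i, IsProbabilityMeasure (μ i)] {f : ∀ i, α i → ℝ≥0∞}
    (hf : ∀ i, Measurable (f i)) :
    ∫⁻ x, ∏ i, f i (x i) ∂Measure.pi μ = ∏ i, ∫⁻ x, f i x ∂μ i := by
  refine (lintegral_prod_eq_prod_lintegral_of_indepFun (μ := Measure.pi μ) Finset.univ
    (fun i (x : ∀ i, α i) => f i (x i))
    (iIndepFun_pi fun i => (hf i).aemeasurable) fun i =>
      (hf i).comp (measurable_pi_apply i)).trans ?_
  exact Finset.prod_congr rfl fun i _ =>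
    (measurePreserving_eval μ i).lintegral_comp (hf i)

/-- It suffices to compare the two measures on boxes, where the product density times the indicator
factors over the coordinates. -/
theorem pi_withDensity {ι : Type*} [Fintype ι] {α : ι → Type*} [∀ i, MeasurableSpace (α i)]
    (μ : ∀ i, Measure (α i)) [∀ i, IsProbabilityMeasure (μ i)] {f : ∀ i, α i → ℝ≥0∞}
    (hf : ∀ i, Measurable (f i)) [∀ i, SigmaFinite ((μ i).withDensity (f i))] :
    Measure.pi (fun i => (μ i).withDensity (f i)) =
      (Measure.pi μ).withDensity fun x => ∏ i, f i (x i) := by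
  refine Measure.pi_eq fun s hs => ?_
  have hs' : MeasurableSet (univ.pi s) := MeasurableSet.univ_pi hs
  rw [withDensity_apply _ hs', ← lintegral_indicator hs']
  have e : ∀ x, (univ.pi s).indicator (fun x => ∏ i, f i (x i)) x
      = ∏ i, (s i).indicator (f i) (x i) := by
    intro x
    by_cases hx : x ∈ univ.pi s
    · rw [indicator_of_mem hx]
      exact Finset.prod_congr rfl fun i _ => (indicator_of_mem (hx i (mem_univ i)) _).symm
    · rw [indicator_of_notMem hx]
      simp only [mem_univ_pi, not_forall] at hx
      obtain ⟨i, hi⟩ := hx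
      exact (Finset.prod_eq_zero (Finset.mem_univ i) (indicator_of_notMem hi _)).symm
  simp only [e]
  rw [lintegral_pi_prod μ fun i => (hf i).indicator (hs i)]
  exact Finset.prod_congr rfl fun i _ => by
    rw [lintegral_indicator (hs i), withDensity_apply _ (hs i)]

theorem gaussianReal_map_add_eq_withDensity (c : ℝ) :
    (gaussianReal 0 1).map (fun x => x + c) =
      (gaussianReal 0 1).withDensity fun x => ENNReal.ofReal (Real.exp (c * x - c ^ 2 / 2)) := by
  rw [gaussianReal_map_add_const, gaussianReal_of_var_ne_zero _ one_ne_zero,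
    gaussianReal_of_var_ne_zero _ one_ne_zero, ← withDensity_mul _ (measurable_gaussianPDF _ _)
      (by fun_prop)]
  congr 1
  ext x
  simp only [gaussianPDF, gaussianPDFReal, Pi.mul_apply]
  rw [← ENNReal.ofReal_mul (by positivity), mul_assoc (√_)⁻¹, ← Real.exp_add]
  congr 3
  simp only [NNReal.coe_one]
  ring

/-- The exponential moment `𝔼 exp (θ N ^ 2 / 2)` of a standard normal random variable `N`. -/
def gaussianSqMoment (θ : ℝ) : ℝ≥0∞ :=
  ∫⁻ x, ENNReal.ofReal (Real.exp (θ / 2 * x ^ 2)) ∂gaussianReal 0 1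

theorem gaussianSqMoment_lt_top {θ : ℝ} (hθ : θ < 1) : gaussianSqMoment θ < ∞ := by
  rw [gaussianSqMoment, gaussianReal_of_var_ne_zero _ one_ne_zero,
    lintegral_withDensity_eq_lintegral_mul _ (measurable_gaussianPDF _ _) (by fun_prop)]
  have h : Integrable fun x : ℝ =>
      (√(2 * Real.pi * 1))⁻¹ * Real.exp (-((1 - θ) / 2) * x ^ 2) :=
    (integrable_exp_neg_mul_sq (by linarith)).const_mul _
  refine lt_of_le_of_lt (le_of_eq (lintegral_congr fun x => ?_))
    ((hasFiniteIntegral_iff_ofReal (Eventually.of_forall fun x => by positivity)).1 h.2)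
  change gaussianPDF 0 1 x * _ = _
  simp only [gaussianPDF, gaussianPDFReal]
  rw [← ENNReal.ofReal_mul (by positivity), mul_assoc (√_)⁻¹, ← Real.exp_add]
  congr 3
  simp only [NNReal.coe_one]
  ring

theorem one_le_gaussianSqMoment {θ : ℝ} (hθ : 0 ≤ θ) : 1 ≤ gaussianSqMoment θ := by
  calc (1 : ℝ≥0∞) = ∫⁻ _, 1 ∂gaussianReal 0 1 := by simp
    _ ≤ _ := lintegral_mono fun x => by
      rw [ENNReal.one_le_ofReal]
      exact Real.one_le_exp (by positivity)

section StdGaussian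

variable {E F : Type*} [NormedAddCommGroup E] [InnerProductSpace ℝ E] [FiniteDimensional ℝ E]
  [MeasurableSpace E] [BorelSpace E] [NormedAddCommGroup F] [InnerProductSpace ℝ F]
  [FiniteDimensional ℝ F] [MeasurableSpace F] [BorelSpace F]

theorem lintegral_stdGaussian {f : E → ℝ≥0∞} (hf : Measurable f) :
    ∫⁻ x, f x ∂stdGaussian E = ∫⁻ y : Fin (Module.finrank ℝ E) → ℝ,
      f (∑ i, y i • stdOrthonormalBasis ℝ E i) ∂(Measure.pi fun _ => gaussianReal 0 1) := by
  rw [stdGaussian, lintegral_map hf (by fun_prop)]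

theorem inner_sum_smul_basis (u : E) (y : Fin (Module.finrank ℝ E) → ℝ) :
    ⟪u, ∑ i, y i • stdOrthonormalBasis ℝ E i⟫_ℝ = ∑ i, ⟪u, stdOrthonormalBasis ℝ E i⟫_ℝ * y i := by
  rw [inner_sum]
  exact Finset.sum_congr rfl fun i _ => by rw [real_inner_smul_right, mul_comm]

theorem norm_sq_sum_smul_basis (y : Fin (Module.finrank ℝ E) → ℝ) :
    ‖∑ i, y i • stdOrthonormalBasis ℝ E i‖ ^ 2 = ∑ i, y i ^ 2 := by
  rw [← real_inner_self_eq_norm_sq, (stdOrthonormalBasis ℝ E).orthonormal.inner_sum]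
  simp [sq]

/-- The Cameron-Martin formula. -/
theorem lintegral_stdGaussian_add (u : E) {f : E → ℝ≥0∞} (hf : Measurable f) :
    ∫⁻ x, f (x + u) ∂stdGaussian E =
      ∫⁻ x, ENNReal.ofReal (Real.exp (⟪u, x⟫_ℝ - ‖u‖ ^ 2 / 2)) * f x ∂stdGaussian E := by
  set b := stdOrthonormalBasis ℝ E
  set c : Fin (Module.finrank ℝ E) → ℝ := fun i => ⟪u, b i⟫_ℝ with hc
  have hu : u = ∑ i, c i • b i := by
    conv_lhs => rw [← b.sum_repr u]
    simp [hc, b.repr_apply_apply, real_inner_comm]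
  have hmap : (Measure.pi fun _ : Fin (Module.finrank ℝ E) => gaussianReal 0 1).map
      (fun y i => y i + c i) = (Measure.pi fun _ => gaussianReal 0 1).withDensity fun y =>
        ∏ i, ENNReal.ofReal (Real.exp (c i * y i - c i ^ 2 / 2)) := by
    have hsf : ∀ i, SigmaFinite ((gaussianReal 0 1).withDensity fun x =>
        ENNReal.ofReal (Real.exp (c i * x - c i ^ 2 / 2))) := fun i => by
      rw [← gaussianReal_map_add_eq_withDensity, gaussianReal_map_add_const]
      infer_instance
    rw [← pi_withDensity (fun _ => gaussianReal 0 1)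
      (f := fun i x => ENNReal.ofReal (Real.exp (c i * x - c i ^ 2 / 2))) fun i => by fun_prop]
    simp_rw [← gaussianReal_map_add_eq_withDensity]
    refine Measure.pi_map_pi (f := fun i x => x + c i)
      (hμ := fun i => by rw [gaussianReal_map_add_const]; infer_instance) fun i => by fun_prop
  have hfb : Measurable fun y : Fin (Module.finrank ℝ E) → ℝ => f (∑ i, y i • b i) :=
    hf.comp (by fun_prop)
  rw [lintegral_stdGaussian (by fun_prop), lintegral_stdGaussian (by fun_prop)]
  calc ∫⁻ y : Fin (Module.finrank ℝ E) → ℝ, f (∑ i, y i • b i + u)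
        ∂(Measure.pi fun _ => gaussianReal 0 1)
      = ∫⁻ y, f (∑ i, y i • b i) ∂(Measure.pi fun _ : Fin (Module.finrank ℝ E) =>
          gaussianReal 0 1).map (fun y i => y i + c i) := by
        rw [lintegral_map hfb (by fun_prop)]
        refine lintegral_congr fun y => ?_
        conv_lhs => rw [hu]
        simp only [add_smul, Finset.sum_add_distrib]
    _ = _ := by
        rw [hmap, lintegral_withDensity_eq_lintegral_mul _ (by fun_prop) hfb]
        refine lintegral_congr fun y => ?_
        rw [Pi.mul_apply, ← ENNReal.ofReal_prod_of_nonneg fun i _ => (Real.exp_pos _).le,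
          ← Real.exp_sum, Finset.sum_sub_distrib, inner_sum_smul_basis, ← Finset.sum_div]
        congr 5
        conv_rhs => rw [hu]
        rw [norm_sq_sum_smul_basis]

/-- This is the Cameron–Martin formula for a constant function. -/
theorem lintegral_exp_inner_stdGaussian (u : E) :
    ∫⁻ x, ENNReal.ofReal (Real.exp ⟪u, x⟫_ℝ) ∂stdGaussian E =
      ENNReal.ofReal (Real.exp (‖u‖ ^ 2 / 2)) := by
  have h := lintegral_stdGaussian_add u (f := fun _ => ENNReal.ofReal (Real.exp (‖u‖ ^ 2 / 2)))
    measurable_const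
  rw [lintegral_const, measure_univ, mul_one] at h
  rw [h]
  refine lintegral_congr fun x => ?_
  rw [← ENNReal.ofReal_mul (Real.exp_pos _).le, ← Real.exp_add, sub_add_cancel]

theorem lintegral_exp_norm_sq_stdGaussian (θ : ℝ) :
    ∫⁻ x, ENNReal.ofReal (Real.exp (θ / 2 * ‖x‖ ^ 2)) ∂stdGaussian E =
      gaussianSqMoment θ ^ Module.finrank ℝ E := by
  rw [lintegral_stdGaussian (by fun_prop)]
  simp only [norm_sq_sum_smul_basis, Finset.mul_sum, Real.exp_sum]
  simp only [ENNReal.ofReal_prod_of_nonneg fun _ _ => (Real.exp_pos _).le]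
  rw [lintegral_pi_prod (fun _ : Fin (Module.finrank ℝ E) => gaussianReal 0 1)
    (f := fun _ x => ENNReal.ofReal (Real.exp (θ / 2 * x ^ 2))) fun i => by fun_prop]
  simp [gaussianSqMoment]

/-- Exponential moments of contracted Gaussian vectors depend only on the dimension of the
target. -/
theorem lintegral_exp_norm_sq_contraction_le (A : E →L[ℝ] F) (hA : ∀ x, ‖A x‖ ≤ ‖x‖) {θ : ℝ}
    (hθ : 0 ≤ θ) :
    ∫⁻ x, ENNReal.ofReal (Real.exp (θ / 2 * ‖A x‖ ^ 2)) ∂stdGaussian E ≤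
      gaussianSqMoment θ ^ Module.finrank ℝ F := by
  have : CompleteSpace E := FiniteDimensional.complete ℝ E
  have : CompleteSpace F := FiniteDimensional.complete ℝ F
  -- The square is linearized by an auxiliary Gaussian vector `g` in `F`. After exchanging the
  -- integrals, the one over `x` yields `exp (θ / 2 * ‖A† g‖²)`, with the adjoint again a
  -- contraction, and only an integral over `F` remains.
  have h1 : ∀ x : E, ENNReal.ofReal (Real.exp (θ / 2 * ‖A x‖ ^ 2)) =
      ∫⁻ g, ENNReal.ofReal (Real.exp ⟪√θ • A x, g⟫_ℝ) ∂stdGaussian F := fun x => by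
    rw [lintegral_exp_inner_stdGaussian, norm_smul, mul_pow, Real.norm_eq_abs, sq_abs,
      Real.sq_sqrt hθ]
    ring_nf
  simp only [h1]
  rw [lintegral_lintegral_swap (by
    refine Continuous.aemeasurable (ENNReal.continuous_ofReal.comp ?_)
    fun_prop)]
  rw [← lintegral_exp_norm_sq_stdGaussian]
  refine lintegral_mono fun g => ?_
  have h2 : ∀ x, ⟪√θ • A x, g⟫_ℝ = ⟪√θ • (ContinuousLinearMap.adjoint A g), x⟫_ℝ := fun x => by
    rw [real_inner_smul_left, real_inner_smul_left, ContinuousLinearMap.adjoint_inner_left,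
      real_inner_comm]
  simp only [h2]
  rw [lintegral_exp_inner_stdGaussian, norm_smul, mul_pow, Real.norm_eq_abs, sq_abs,
    Real.sq_sqrt hθ]
  refine ENNReal.ofReal_le_ofReal (Real.exp_le_exp.2 ?_)
  have h3 : ‖ContinuousLinearMap.adjoint A g‖ ≤ ‖g‖ := by
    refine (ContinuousLinearMap.le_opNorm _ _).trans (mul_le_of_le_one_left (norm_nonneg _) ?_)
    rw [LinearIsometryEquiv.norm_map]
    exact A.opNorm_le_bound zero_le_one fun x => by simpa using hA x
  have := pow_le_pow_left₀ (norm_nonneg _) h3 2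
  nlinarith

/-- The Cameron-Martin lower bound for the Gaussian measure of a shifted symmetric set. -/
theorem exp_mul_stdGaussian_le_shift (u : E) {A : Set E} (hA : MeasurableSet A)
    (hneg : ∀ x, -x ∈ A ↔ x ∈ A) :
    ENNReal.ofReal (Real.exp (-(‖u‖ ^ 2 / 2))) * stdGaussian E A ≤
      stdGaussian E {x | x - u ∈ A} := by
  have hsymm : (stdGaussian E).map (fun x => -x) = stdGaussian E :=
    stdGaussian_map (LinearIsometryEquiv.neg ℝ)
  set ind : E → ℝ≥0∞ := A.indicator 1 with hind
  have hindm : Measurable ind := measurable_one.indicator hA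
  have hms : ∀ w : E, MeasurableSet {x | x - w ∈ A} := fun w =>
    (show Measurable fun x : E => x - w by fun_prop) hA
  have e1 : ∀ w : E, stdGaussian E {x | x - w ∈ A} = ∫⁻ x,
      ENNReal.ofReal (Real.exp (⟪-w, x⟫_ℝ - ‖w‖ ^ 2 / 2)) * ind x ∂stdGaussian E := fun w => by
    have h := lintegral_stdGaussian_add (-w) hindm
    rw [norm_neg] at h
    rw [← h, ← lintegral_indicator_one (hms w)]
    simp only [← sub_eq_add_neg]
    rfl
  have e2 : stdGaussian E {x | x - -u ∈ A} = stdGaussian E {x | x - u ∈ A} := by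
    conv_lhs => rw [← hsymm]
    rw [Measure.map_apply (by fun_prop) (hms (-u))]
    congr 1
    ext x
    simp only [mem_preimage, mem_ofPred_eq]
    rw [← hneg]
    congr! 1
    abel
  -- By symmetry the shifts by `u` and `-u` have the same mass. Adding their densities removes the
  -- linear term, since `exp t + exp (-t) ≥ 2`.
  have e3 : 2 * (ENNReal.ofReal (Real.exp (-(‖u‖ ^ 2 / 2))) * stdGaussian E A) ≤
      2 * stdGaussian E {x | x - u ∈ A} := by
    rw [two_mul (stdGaussian E _)]
    nth_rw 1 [← e2]
    rw [e1, e1, ← lintegral_add_left (by fun_prop), ← lintegral_indicator_one hA, ← mul_assoc,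
      ← lintegral_const_mul _ hindm]
    refine lintegral_mono fun x => ?_
    rw [← add_mul]
    refine mul_le_mul_left ?_ _
    rw [norm_neg, neg_neg, ← ENNReal.ofReal_add (Real.exp_pos _).le (Real.exp_pos _).le,
      ← ENNReal.ofReal_ofNat, ← ENNReal.ofReal_mul (by norm_num)]
    refine ENNReal.ofReal_le_ofReal ?_
    rw [inner_neg_left]
    have h := Real.add_one_le_exp ⟪u, x⟫_ℝ
    have h' := Real.add_one_le_exp (-⟪u, x⟫_ℝ)
    rw [sub_eq_add_neg, sub_eq_add_neg, Real.exp_add, Real.exp_add]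
    nlinarith [Real.exp_pos (-(‖u‖ ^ 2 / 2))]
  exact (ENNReal.mul_le_mul_iff_right two_ne_zero (by simp)).1 e3

end StdGaussian

/-- By independence the characteristic function is a product of Gaussian ones, whose exponents add
up to the squared `ℓ²` norm. -/
theorem hasLaw_toLp_stdGaussian {H : Type*} [NormedAddCommGroup H] [InnerProductSpace ℝ H]
    [FiniteDimensional ℝ H] [MeasurableSpace H] [BorelSpace H] {Ω : Type*} [MeasurableSpace Ω]
    {P : Measure Ω} [IsProbabilityMeasure P] {X : ℕ → Ω → H}
    (hX : ∀ n, HasLaw (X n) (stdGaussian H) P) (hind : iIndepFun X P) (n : ℕ) :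
    HasLaw (fun ω => WithLp.toLp 2 fun i : Fin n => X i ω)
      (stdGaussian (PiLp 2 fun _ : Fin n => H)) P := by
  have : CompleteSpace H := FiniteDimensional.complete ℝ H
  have hm : ∀ i : Fin n, AEMeasurable (X i) P := fun i => (hX i).aemeasurable
  refine ⟨by fun_prop, ?_⟩
  apply Measure.ext_of_charFun
  ext t
  have hi : iIndepFun (fun i : Fin n => X i) P := hind.precomp Fin.val_injective
  rw [(iIndepFun_iff_charFun_pi hm).1 hi, charFun_stdGaussian, ← Complex.ofReal_pow,
    PiLp.norm_sq_eq_of_L2]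
  simp_rw [(hX _).map_eq, charFun_stdGaussian, ← Complex.exp_sum]
  congr 1
  push_cast
  rw [← Finset.sum_div, Finset.sum_neg_distrib]

/-! ### The Gaussian Legendre transform -/

section Cramer

variable {H : Type*} [NormedAddCommGroup H] [InnerProductSpace ℝ H] [FiniteDimensional ℝ H]
  [MeasurableSpace H] [BorelSpace H]

theorem logMGF_stdGaussian (w : H) : logMGF (stdGaussian H) w = ((‖w‖ ^ 2 / 2 : ℝ) : EReal) := by
  rw [logMGF, lintegral_exp_inner_stdGaussian, ENNReal.log_ofReal_of_pos (Real.exp_pos _),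
    Real.log_exp]

theorem legendre_stdGaussian (u : H) : legendre (stdGaussian H) u = ((‖u‖ ^ 2 / 2 : ℝ) : EReal) := by
  simp only [legendre, logMGF_stdGaussian, ← EReal.coe_sub]
  refine le_antisymm (iSup_le fun w => ?_) (le_iSup_of_le u ?_)
  · rw [EReal.coe_le_coe_iff]
    nlinarith [real_inner_le_norm w u, sq_nonneg (‖w‖ - ‖u‖)]
  · rw [EReal.coe_le_coe_iff, real_inner_self_eq_norm_sq]
    linarith

theorem toENNReal_legendre_stdGaussian (u : H) :
    (legendre (stdGaussian H) u).toENNReal = ‖u‖ₑ ^ 2 / 2 := by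
  rw [legendre_stdGaussian, EReal.real_coe_toENNReal, ENNReal.ofReal_div_of_pos two_pos,
    ENNReal.ofReal_pow (norm_nonneg _), ofReal_norm, ENNReal.ofReal_ofNat]

theorem rateJ_stdGaussian {V : Type*} [NormedAddCommGroup V] [NormedSpace ℝ V]
    {B : StepTwoBracket H V} (x : CarnotGroup B) :
    rateJ (stdGaussian H) x =
      ⨅ γ ∈ CarnotGroup.horizontalPaths 1 x, CarnotGroup.energy γ / 2 := by
  simp only [rateJ, toENNReal_legendre_stdGaussian, CarnotGroup.energy, div_eq_mul_inv]
  simp only [lintegral_mul_const' _ _ (ENNReal.inv_ne_top.2 (two_ne_zero (α := ℝ≥0∞)))]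

end Cramer

/-! ### Block decomposition and perturbation of walks -/

namespace CarnotGroup

variable {H V : Type*} [NormedAddCommGroup H] [InnerProductSpace ℝ H]
  [NormedAddCommGroup V] [NormedSpace ℝ V] {B : StepTwoBracket H V}

theorem walk_congr {y z : ℕ → H} {n : ℕ} (h : ∀ k < n, y k = z k) : walk B y n = walk B z n := by
  induction n with
  | zero => rfl
  | succ n ih =>
    rw [walk_succ, walk_succ, ih fun k hk => h k (hk.trans n.lt_succ_self), h n n.lt_succ_self]

theorem hor_inv_walk_mul_walk (y : ℕ → H) {a b : ℕ} (hab : a ≤ b) :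
    hor ((walk B y a)⁻¹ * walk B y b) = ∑ k ∈ Finset.Ico a b, y k := by
  rw [hor_mul, hor_inv, hor_walk, hor_walk, Finset.sum_Ico_eq_sub _ hab, neg_add_eq_sub]

theorem hor_inv_walk_mul_walk_add (u y : ℕ → H) (n : ℕ) :
    hor ((walk B u n)⁻¹ * walk B (fun k => u k + y k) n) = ∑ k ∈ Finset.range n, y k := by
  simp [hor_walk, Finset.sum_add_distrib]

/-- The discrepancy `z` of the two walks obeys the recursion `z ↦ expH (-u n) * z * expH (u n + y
n)`. Its horizontal part is the sum of the perturbations alone, so each step adds only brackets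
containing a perturbation. -/
theorem ver_inv_walk_mul_walk_add (u y : ℕ → H) (n : ℕ) :
    ver ((walk B u n)⁻¹ * walk B (fun k => u k + y k) n) =
      ∑ k ∈ Finset.range n, (B.br (∑ i ∈ Finset.range k, y i) (u k)
        + (1 / 2 : ℝ) • B.br (y k) (u k)
        + (1 / 2 : ℝ) • B.br (∑ i ∈ Finset.range k, y i) (y k)) := by
  induction n with
  | zero => simp
  | succ n ih =>
    have e : (walk B u (n + 1))⁻¹ * walk B (fun k => u k + y k) (n + 1) =
        expH (-u n) * ((walk B u n)⁻¹ * walk B (fun k => u k + y k) n) * expH (u n + y n) := by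
      rw [walk_succ, walk_succ, ← expH_inv]
      group
    rw [e, Finset.sum_range_succ, ← ih, ← hor_inv_walk_mul_walk_add (B := B) u y n]
    set z := (walk B u n)⁻¹ * walk B (fun k => u k + y k) n
    rw [ver_mul, ver_mul (expH (-u n)), hor_mul (expH (-u n))]
    simp only [ver_expH, hor_expH, map_add, map_neg, LinearMap.add_apply, LinearMap.neg_apply,
      B.br_self, br_swap (hor z) (u n), br_swap (u n) (y n)]
    module

theorem sum_range_sum_Ico {M : Type*} [AddCommMonoid M] (f : ℕ → M) {b : ℕ → ℕ} (hb : Monotone b)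
    (m : ℕ) : ∑ j ∈ Finset.range m, ∑ i ∈ Finset.Ico (b j) (b (j + 1)), f i
      = ∑ i ∈ Finset.Ico (b 0) (b m), f i := by
  induction m with
  | zero => simp
  | succ m ih =>
    rw [Finset.sum_range_succ, ih, Finset.sum_Ico_consecutive _ (hb m.zero_le) (hb m.le_succ)]

variable [FiniteDimensional ℝ V] [FiniteDimensional ℝ H]

/-- This is the discrete counterpart of the vertical bound in `IsHorizontal.increment_le`. -/
theorem norm_ver_inv_walk_mul_walk_le (y : ℕ → H) {a b : ℕ} (hab : a ≤ b) :
    ‖ver ((walk B y a)⁻¹ * walk B y b)‖ ≤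
      ‖brL B‖ * (∑ k ∈ Finset.Ico a b, ‖y k‖) ^ 2 := by
  induction b, hab using Nat.le_induction with
  | base => simp
  | succ b hab ih =>
    have e : (walk B y a)⁻¹ * walk B y (b + 1) = ((walk B y a)⁻¹ * walk B y b) * expH (y b) := by
      rw [walk_succ, mul_assoc]
    rw [e, ver_mul, hor_inv_walk_mul_walk y hab, ver_expH, add_zero, hor_expH,
      Finset.sum_Ico_succ_top hab]
    set σ := ∑ k ∈ Finset.Ico a b, ‖y k‖
    have hσ : 0 ≤ σ := Finset.sum_nonneg fun _ _ => norm_nonneg _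
    have h1 : ‖(1 / 2 : ℝ) • B.br (∑ k ∈ Finset.Ico a b, y k) (y b)‖ ≤ ‖brL B‖ * σ * ‖y b‖ := by
      rw [norm_smul, Real.norm_of_nonneg (by norm_num)]
      refine (mul_le_of_le_one_left (norm_nonneg _) (by norm_num)).trans ((norm_br_le _ _).trans ?_)
      gcongr
      exact norm_sum_le _ _
    refine (norm_add_le _ _).trans ((add_le_add ih h1).trans ?_)
    have h2 : 0 ≤ ‖brL B‖ * (σ * ‖y b‖ + ‖y b‖ ^ 2) := by positivity
    nlinarith

/-- The word norm of a walk is controlled by the sums over blocks of length `l`. -/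
theorem wordNorm_walk_le_blocks {C : ℝ} (hC0 : 0 ≤ C)
    (hC : ∀ x : CarnotGroup B, ∀ v, wordNorm (x * mk 0 v) ≤ wordNorm x + C * √‖v‖)
    (y : ℕ → H) {n m l : ℕ} {b : ℕ → ℕ} (hb : Monotone b) (hb0 : b 0 = 0) (hbm : b m = n)
    (hbl : ∀ j, b (j + 1) - b j ≤ l) :
    wordNorm (walk B y n) ≤
      ∑ j ∈ Finset.range m, ‖∑ i ∈ Finset.Ico (b j) (b (j + 1)), y i‖
        + C * √(‖brL B‖ * (l * ∑ i ∈ Finset.range n, ‖y i‖ ^ 2)) := by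
  have h := wordNorm_inv_mul_le hC0 hC (fun j => walk B y (b j)) m
  simp only [hb0, hbm, walk_zero, inv_one, one_mul] at h
  refine h.trans (add_le_add (Finset.sum_le_sum fun j _ => ?_) ?_)
  · rw [hor_inv_walk_mul_walk y (hb j.le_succ)]
  · gcongr
    have hs := sum_range_sum_Ico (fun i => ‖y i‖ ^ 2) hb m
    rw [hb0, hbm, ← Finset.range_eq_Ico] at hs
    rw [← hs, Finset.mul_sum, Finset.mul_sum]
    refine Finset.sum_le_sum fun j _ => (norm_ver_inv_walk_mul_walk_le y (hb j.le_succ)).trans ?_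
    gcongr
    -- Cauchy–Schwarz within a block turns the squared length into at most `l` times the sum of
    -- squares.
    refine sq_sum_le_card_mul_sum_sq.trans ?_
    rw [Nat.card_Ico]
    gcongr
    exact hbl j

theorem sum_mul_le_sqrt_mul_sqrt {ι : Type*} (s : Finset ι) (f g : ι → ℝ) {a b : ℝ}
    (hf : ∑ i ∈ s, f i ^ 2 ≤ a) (hg : ∑ i ∈ s, g i ^ 2 ≤ b) :
    ∑ i ∈ s, f i * g i ≤ √a * √b := by
  refine (Real.sum_mul_le_sqrt_mul_sqrt s f g).trans ?_
  gcongr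

/-- The effect of a perturbation of the steps on the end point of the walk. -/
theorem norm_ver_inv_walk_mul_walk_add_le {u y : ℕ → H} {n : ℕ} {L c : ℝ} (hL : ∀ k < n, ‖u k‖ ≤ L)
    (hS : ∑ k ∈ Finset.range n, ‖∑ i ∈ Finset.range k, y i‖ ^ 2 ≤ c * n ^ 2)
    (hy : ∑ k ∈ Finset.range n, ‖y k‖ ^ 2 ≤ c * n) (hL0 : 0 ≤ L) :
    ‖ver ((walk B u n)⁻¹ * walk B (fun k => u k + y k) n)‖ ≤
      ‖brL B‖ * (2 * (L * √c) + c) * (n * √n) := by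
  rw [ver_inv_walk_mul_walk_add]
  set S : ℕ → H := fun k => ∑ i ∈ Finset.range k, y i with hSdef
  -- The hypothesis `hy` forces `c ≥ 0` unless there are no steps.
  have hc : 0 ≤ c ∨ n = 0 := by
    rcases Nat.eq_zero_or_pos n with h | h
    · exact Or.inr h
    · refine Or.inl ?_
      have h1 : 0 ≤ c * n := (Finset.sum_nonneg fun _ _ => sq_nonneg _).trans hy
      exact nonneg_of_mul_nonneg_left h1 (by exact_mod_cast h)
  rcases hc with hc | rfl
  swap
  · simp
  have hone : ∑ _k ∈ Finset.range n, (1 : ℝ) ^ 2 ≤ n := by simp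
  have hS1 : ∑ k ∈ Finset.range n, ‖S k‖ ≤ √c * (n * √n) := by
    have := sum_mul_le_sqrt_mul_sqrt _ (fun k => ‖S k‖) (fun _ => 1) hS hone
    simp only [mul_one] at this
    refine this.trans_eq ?_
    rw [Real.sqrt_mul hc, Real.sqrt_sq (Nat.cast_nonneg n)]
    ring
  have hy1 : ∑ k ∈ Finset.range n, ‖y k‖ ≤ √c * (n * √n) := by
    have := sum_mul_le_sqrt_mul_sqrt _ (fun k => ‖y k‖) (fun _ => 1) hy hone
    simp only [mul_one] at this
    refine this.trans ?_
    rw [Real.sqrt_mul hc, mul_assoc]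
    have : √(n : ℝ) ≤ n := Real.sqrt_le_iff.2
      ⟨n.cast_nonneg, by exact_mod_cast Nat.le_self_pow two_ne_zero n⟩
    gcongr
  have hSy : ∑ k ∈ Finset.range n, ‖S k‖ * ‖y k‖ ≤ c * (n * √n) := by
    refine (sum_mul_le_sqrt_mul_sqrt _ (fun k => ‖S k‖) (fun k => ‖y k‖) hS hy).trans_eq ?_
    rw [Real.sqrt_mul hc, Real.sqrt_mul hc, Real.sqrt_sq (Nat.cast_nonneg n)]
    linear_combination (n * √n) * Real.mul_self_sqrt hc
  have hterm : ∀ k ∈ Finset.range n, ‖B.br (S k) (u k) + (1 / 2 : ℝ) • B.br (y k) (u k)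
      + (1 / 2 : ℝ) • B.br (S k) (y k)‖ ≤
        ‖brL B‖ * (L * ‖S k‖ + L * ‖y k‖ + ‖S k‖ * ‖y k‖) := by
    intro k hk
    have hu := hL k (Finset.mem_range.1 hk)
    have half : ∀ v : V, ‖(1 / 2 : ℝ) • v‖ ≤ ‖v‖ := fun v => by
      rw [norm_smul, Real.norm_of_nonneg (by norm_num)]
      exact mul_le_of_le_one_left (norm_nonneg _) (by norm_num)
    have h1 : ‖B.br (S k) (u k)‖ ≤ ‖brL B‖ * ‖S k‖ * L := (norm_br_le _ _).trans (by gcongr)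
    have h2 : ‖B.br (y k) (u k)‖ ≤ ‖brL B‖ * ‖y k‖ * L := (norm_br_le _ _).trans (by gcongr)
    have h3 := norm_br_le (B := B) (S k) (y k)
    refine norm_add₃_le.trans ?_
    linarith [half (B.br (y k) (u k)), half (B.br (S k) (y k))]
  refine (norm_sum_le _ _).trans ((Finset.sum_le_sum hterm).trans ?_)
  rw [← Finset.mul_sum, Finset.sum_add_distrib, Finset.sum_add_distrib, ← Finset.mul_sum,
    ← Finset.mul_sum, mul_assoc]
  gcongr
  linarith [mul_le_mul_of_nonneg_left hS1 hL0, mul_le_mul_of_nonneg_left hy1 hL0]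

end CarnotGroup

/-! ## Exponential estimates for the Gaussian walk -/

section Tails

variable {E F : Type*} [NormedAddCommGroup E] [InnerProductSpace ℝ E] [FiniteDimensional ℝ E]
  [MeasurableSpace E] [BorelSpace E] [NormedAddCommGroup F] [InnerProductSpace ℝ F]
  [FiniteDimensional ℝ F] [MeasurableSpace F] [BorelSpace F]

/-- A Chernoff bound. The prefactor sees only the dimension of `F`, so it stays fixed when `E` grows
with the number of steps and `F` does not. -/
theorem stdGaussian_le_norm_sq_contraction (A : E →L[ℝ] F) (hA : ∀ x, ‖A x‖ ≤ ‖x‖) {θ : ℝ}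
    (hθ : 0 ≤ θ) (a : ℝ) :
    stdGaussian E {x | a ≤ ‖A x‖ ^ 2} ≤
      gaussianSqMoment θ ^ Module.finrank ℝ F * ENNReal.ofReal (Real.exp (-(θ / 2 * a))) := by
  have h := mul_meas_ge_le_lintegral (μ := stdGaussian E)
    (f := fun x => ENNReal.ofReal (Real.exp (θ / 2 * ‖A x‖ ^ 2))) (by fun_prop)
    (ENNReal.ofReal (Real.exp (θ / 2 * a)))
  have hsub : {x : E | a ≤ ‖A x‖ ^ 2} ⊆ {x | ENNReal.ofReal (Real.exp (θ / 2 * a)) ≤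
      ENNReal.ofReal (Real.exp (θ / 2 * ‖A x‖ ^ 2))} := fun x hx =>
    ENNReal.ofReal_le_ofReal (Real.exp_le_exp.2 (mul_le_mul_of_nonneg_left hx (by positivity)))
  have h1 := (mul_le_mul_right (measure_mono hsub) _).trans
    (h.trans (lintegral_exp_norm_sq_contraction_le A hA hθ))
  calc stdGaussian E {x | a ≤ ‖A x‖ ^ 2}
      = ENNReal.ofReal (Real.exp (θ / 2 * a)) * stdGaussian E {x | a ≤ ‖A x‖ ^ 2} *
          ENNReal.ofReal (Real.exp (-(θ / 2 * a))) := by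
        rw [mul_right_comm, ← ENNReal.ofReal_mul (Real.exp_pos _).le, ← Real.exp_add]
        simp
    _ ≤ _ := mul_le_mul_left h1 _

theorem lintegral_norm_sq_contraction_le (A : E →L[ℝ] F) (hA : ∀ x, ‖A x‖ ≤ ‖x‖) :
    ∫⁻ x, ENNReal.ofReal (‖A x‖ ^ 2) ∂stdGaussian E ≤
      4 * gaussianSqMoment (1 / 2) ^ Module.finrank ℝ F := by
  refine le_trans ?_ (mul_le_mul_right
    (lintegral_exp_norm_sq_contraction_le A hA (θ := 1 / 2) (by norm_num)) 4)
  rw [← lintegral_const_mul _ (by fun_prop)]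
  refine lintegral_mono fun x => ?_
  rw [← ENNReal.ofReal_ofNat, ← ENNReal.ofReal_mul (by norm_num)]
  refine ENNReal.ofReal_le_ofReal ?_
  have := Real.add_one_le_exp (1 / 2 / 2 * ‖A x‖ ^ 2)
  linarith

end Tails

/-- The space of the first `n` steps. -/
abbrev StepSpace (H : Type*) [NormedAddCommGroup H] [InnerProductSpace ℝ H] (n : ℕ) : Type _ :=
  PiLp 2 fun _ : Fin n => H

section Steps

variable {H : Type*} [NormedAddCommGroup H] [InnerProductSpace ℝ H]

/-- The `i`-th step, which is `0` for `i ≥ n`. -/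
def stepL (n i : ℕ) : StepSpace H n →L[ℝ] H :=
  if h : i < n then PiLp.proj 2 (fun _ : Fin n => H) ⟨i, h⟩ else 0

theorem stepL_of_lt {n i : ℕ} (h : i < n) (x : StepSpace H n) : stepL n i x = x ⟨i, h⟩ := by
  simp [stepL, h]

theorem sum_norm_sq_stepL {n : ℕ} (x : StepSpace H n) :
    ∑ i ∈ Finset.range n, ‖stepL n i x‖ ^ 2 = ‖x‖ ^ 2 := by
  rw [PiLp.norm_sq_eq_of_L2, Finset.sum_range]
  simp [stepL_of_lt]

theorem norm_sq_sum_stepL_le {n : ℕ} {s : Finset ℕ} (hs : s ⊆ Finset.range n)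
    (x : StepSpace H n) : ‖∑ i ∈ s, stepL n i x‖ ^ 2 ≤ s.card * ‖x‖ ^ 2 := by
  rw [← sum_norm_sq_stepL]
  calc ‖∑ i ∈ s, stepL n i x‖ ^ 2 ≤ (∑ i ∈ s, ‖stepL n i x‖) ^ 2 := by
        gcongr
        exact norm_sum_le _ _
    _ ≤ s.card * ∑ i ∈ s, ‖stepL n i x‖ ^ 2 := sq_sum_le_card_mul_sum_sq
    _ ≤ _ := by
        gcongr

theorem norm_stepL_le (n i : ℕ) (x : StepSpace H n) : ‖stepL n i x‖ ≤ ‖x‖ := by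
  by_cases h : i < n
  · rw [stepL_of_lt h]
    exact PiLp.norm_apply_le x _
  · simp [stepL, h]

variable [FiniteDimensional ℝ H]

theorem finrank_stepSpace (n : ℕ) :
    Module.finrank ℝ (StepSpace H n) = n * Module.finrank ℝ H := by
  rw [(WithLp.linearEquiv 2 ℝ (Fin n → H)).finrank_eq, Module.finrank_pi_fintype]
  simp

/-- The normalized sums over the blocks `[b j, b (j + 1))`. -/
def blockL (b : ℕ → ℕ) (n m : ℕ) : StepSpace H n →L[ℝ] StepSpace H m :=
  LinearMap.toContinuousLinearMap
    { toFun := fun x => WithLp.toLp 2 fun j : Fin m =>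
        (√((b (j + 1) - b j : ℕ) : ℝ))⁻¹ • ∑ i ∈ Finset.Ico (b j) (b (j + 1)), stepL n i x
      map_add' := fun x y => by
        ext j
        simp [Finset.sum_add_distrib]
      map_smul' := fun c x => by
        ext j
        simp only [map_smul, ← Finset.smul_sum, RingHom.id_apply, PiLp.smul_apply]
        rw [smul_comm] }

theorem blockL_apply (b : ℕ → ℕ) (n m : ℕ) (x : StepSpace H n) (j : Fin m) :
    blockL b n m x j =
      (√((b (j + 1) - b j : ℕ) : ℝ))⁻¹ • ∑ i ∈ Finset.Ico (b j) (b (j + 1)), stepL n i x := rfl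

/-- Cauchy–Schwarz in each block loses a factor equal to the block length, which the normalization
cancels. An empty block contributes `0`, both as a sum and through `(√0)⁻¹ = 0`. -/
theorem norm_blockL_le {b : ℕ → ℕ} {n m : ℕ} (hb : Monotone b) (hb0 : b 0 = 0) (hbm : b m = n)
    (x : StepSpace H n) : ‖blockL b n m x‖ ≤ ‖x‖ := by
  refine le_of_sq_le_sq ?_ (norm_nonneg _)
  have hs := CarnotGroup.sum_range_sum_Ico (fun i => ‖stepL n i x‖ ^ 2) hb m
  rw [hb0, hbm, ← Finset.range_eq_Ico, sum_norm_sq_stepL, Finset.sum_range] at hs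
  rw [← hs, PiLp.norm_sq_eq_of_L2]
  refine Finset.sum_le_sum fun j _ => ?_
  rw [blockL_apply, norm_smul, mul_pow, norm_inv, inv_pow, Real.norm_eq_abs, sq_abs,
    Real.sq_sqrt (Nat.cast_nonneg _)]
  have h1 : ‖∑ i ∈ Finset.Ico (b j) (b (j + 1)), stepL n i x‖ ^ 2 ≤
      ((b (j + 1) - b j : ℕ) : ℝ) * ∑ i ∈ Finset.Ico (b j) (b (j + 1)), ‖stepL n i x‖ ^ 2 := by
    refine le_trans (pow_le_pow_left₀ (norm_nonneg _) (norm_sum_le _ _) 2) ?_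
    refine sq_sum_le_card_mul_sum_sq.trans_eq ?_
    rw [Nat.card_Ico]
  refine inv_mul_le_of_le_mul₀ (Nat.cast_nonneg _) (Finset.sum_nonneg fun _ _ => sq_nonneg _) h1

/-- Cauchy–Schwarz with the square roots of the block lengths as weights. The lengths add up to `n`,
so the constant does not depend on the number of blocks. -/
theorem sum_norm_block_le {b : ℕ → ℕ} {n m : ℕ} (hb : Monotone b) (hb0 : b 0 = 0) (hbm : b m = n)
    (x : StepSpace H n) :
    ∑ j ∈ Finset.range m, ‖∑ i ∈ Finset.Ico (b j) (b (j + 1)), stepL n i x‖ ≤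
      √n * ‖blockL b n m x‖ := by
  have h1 : ∀ j : Fin m, ‖∑ i ∈ Finset.Ico (b j) (b (j + 1)), stepL n i x‖ =
      √((b (j + 1) - b j : ℕ) : ℝ) * ‖blockL b n m x j‖ := fun j => by
    rw [blockL_apply, norm_smul, norm_inv, Real.norm_of_nonneg (Real.sqrt_nonneg _)]
    rcases Nat.eq_zero_or_pos (b (j + 1) - b j) with h | h
    · rw [Finset.Ico_eq_empty_of_le (Nat.sub_eq_zero_iff_le.1 h)]
      simp
    · rw [mul_inv_cancel_left₀ (Real.sqrt_ne_zero'.2 (by exact_mod_cast h))]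
  rw [Finset.sum_range]
  simp only [h1]
  refine (CarnotGroup.sum_mul_le_sqrt_mul_sqrt (a := n) (b := ‖blockL b n m x‖ ^ 2) _ _ _ ?_
    ?_).trans_eq ?_
  · simp only [Real.sq_sqrt (Nat.cast_nonneg _)]
    have hs := CarnotGroup.sum_range_sum_Ico (fun _ => (1 : ℝ)) hb m
    rw [hb0, hbm, Finset.sum_range] at hs
    simp only [Finset.sum_const, Nat.card_Ico, nsmul_eq_mul, mul_one, Nat.sub_zero] at hs
    exact hs.le
  · rw [PiLp.norm_sq_eq_of_L2]
  · rw [Real.sqrt_sq (norm_nonneg _)]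

variable [MeasurableSpace H] [BorelSpace H]

theorem lintegral_norm_sq_sum_stepL_le {n : ℕ} {s : Finset ℕ} (hs : s ⊆ Finset.range n) :
    ∫⁻ x, ENNReal.ofReal (‖∑ i ∈ s, stepL n i x‖ ^ 2) ∂stdGaussian (StepSpace H n) ≤
      n * (4 * gaussianSqMoment (1 / 2) ^ Module.finrank ℝ H) := by
  rcases Nat.eq_zero_or_pos n with rfl | hn
  · have : s = ∅ := by simpa using hs
    simp [this]
  have hn' : (0 : ℝ) < n := by exact_mod_cast hn
  have hcard : (s.card : ℝ) ≤ n := by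
    exact_mod_cast (Finset.card_le_card hs).trans_eq (Finset.card_range n)
  have h := lintegral_norm_sq_contraction_le ((√(n : ℝ))⁻¹ • ∑ i ∈ s, stepL (H := H) n i) ?_
  · refine le_trans (le_of_eq ?_) (mul_le_mul_right h (n : ℝ≥0∞))
    rw [← lintegral_const_mul _ (by fun_prop)]
    refine lintegral_congr fun x => ?_
    rw [← ENNReal.ofReal_natCast, ← ENNReal.ofReal_mul hn'.le]
    congr 1
    rw [smul_apply, sum_apply, norm_smul, mul_pow, norm_inv,
      inv_pow, Real.norm_eq_abs, sq_abs, Real.sq_sqrt hn'.le, mul_inv_cancel_left₀ hn'.ne']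
  · intro x
    refine le_of_sq_le_sq ?_ (norm_nonneg _)
    rw [smul_apply, sum_apply, norm_smul, mul_pow, norm_inv,
      inv_pow, Real.norm_eq_abs, sq_abs, Real.sq_sqrt hn'.le, inv_mul_le_iff₀ hn']
    exact (norm_sq_sum_stepL_le hs x).trans (by gcongr)

/-- A quadratic functional that controls the fluctuations of the partial sums. -/
def fluctuation (n : ℕ) (x : StepSpace H n) : ℝ :=
  ∑ k ∈ Finset.range n, ‖∑ i ∈ Finset.range k, stepL n i x‖ ^ 2 +
    ∑ k ∈ Finset.range n, n * ‖stepL n k x‖ ^ 2 + n * ‖∑ i ∈ Finset.range n, stepL n i x‖ ^ 2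

theorem continuous_fluctuation (n : ℕ) : Continuous (fluctuation (H := H) n) := by
  unfold fluctuation
  fun_prop

theorem fluctuation_neg {n : ℕ} (x : StepSpace H n) : fluctuation n (-x) = fluctuation n x := by
  simp [fluctuation, Finset.sum_neg_distrib]

/-- The weights in `fluctuation` are chosen so that each of its three terms has expectation at most
a constant times `n²`. -/
theorem lintegral_fluctuation_le (n : ℕ) :
    ∫⁻ x, ENNReal.ofReal (fluctuation n x) ∂stdGaussian (StepSpace H n) ≤
      3 * n ^ 2 * (4 * gaussianSqMoment (1 / 2) ^ Module.finrank ℝ H) := by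
  set M := 4 * gaussianSqMoment (1 / 2) ^ Module.finrank ℝ H
  have e : ∀ x : StepSpace H n, ENNReal.ofReal (fluctuation n x) =
      ∑ k ∈ Finset.range n, ENNReal.ofReal (‖∑ i ∈ Finset.range k, stepL n i x‖ ^ 2) +
        ∑ k ∈ Finset.range n, n * ENNReal.ofReal (‖stepL n k x‖ ^ 2) +
          n * ENNReal.ofReal (‖∑ i ∈ Finset.range n, stepL n i x‖ ^ 2) := fun x => by
    rw [fluctuation, ENNReal.ofReal_add (by positivity) (by positivity),
      ENNReal.ofReal_add (by positivity) (by positivity),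
      ENNReal.ofReal_sum_of_nonneg fun _ _ => by positivity,
      ENNReal.ofReal_sum_of_nonneg fun _ _ => by positivity]
    simp only [ENNReal.ofReal_mul (Nat.cast_nonneg (α := ℝ) n), ENNReal.ofReal_natCast]
  simp only [e]
  rw [lintegral_add_right _ (by fun_prop), lintegral_add_right _ (by fun_prop),
    lintegral_finsetSum _ (fun _ _ => by fun_prop), lintegral_finsetSum _ (fun _ _ => by fun_prop),
    lintegral_const_mul _ (by fun_prop)]
  have h1 : ∑ k ∈ Finset.range n, ∫⁻ x, ENNReal.ofReal (‖∑ i ∈ Finset.range k, stepL n i x‖ ^ 2)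
      ∂stdGaussian (StepSpace H n) ≤ n * (n * M) := by
    refine (Finset.sum_le_card_nsmul _ _ (n * M) fun k hk => ?_).trans_eq (by simp)
    exact lintegral_norm_sq_sum_stepL_le
      (Finset.range_subset_range.2 (Finset.mem_range.1 hk).le)
  have h2 : ∑ k ∈ Finset.range n, ∫⁻ x, n * ENNReal.ofReal (‖stepL n k x‖ ^ 2)
      ∂stdGaussian (StepSpace H n) ≤ n * (n * M) := by
    refine (Finset.sum_le_card_nsmul _ _ (n * M) fun k _ => ?_).trans_eq (by simp)
    rw [lintegral_const_mul _ (by fun_prop)]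
    gcongr
    exact lintegral_norm_sq_contraction_le _ (norm_stepL_le n k)
  have h3 := lintegral_norm_sq_sum_stepL_le (H := H) (Finset.Subset.refl (Finset.range n))
  refine (add_le_add (add_le_add h1 h2) (mul_le_mul_right h3 _)).trans_eq ?_
  ring

/-- Markov's inequality, with a threshold equal to twice the bound on the expectation. -/
theorem exists_half_le_stdGaussian_fluctuation (H : Type*) [NormedAddCommGroup H]
    [InnerProductSpace ℝ H] [FiniteDimensional ℝ H] [MeasurableSpace H] [BorelSpace H] :
    ∃ c : ℝ, 0 < c ∧ ∀ n : ℕ, 0 < n →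
      1 / 2 ≤ stdGaussian (StepSpace H n) {x | fluctuation n x < c * n ^ 2} := by
  set M := 4 * gaussianSqMoment (1 / 2) ^ Module.finrank ℝ H with hM
  have hMtop : M ≠ ∞ := ENNReal.mul_ne_top (by simp)
    (ENNReal.pow_ne_top (gaussianSqMoment_lt_top (by norm_num)).ne)
  have hM0 : M ≠ 0 := mul_ne_zero (by simp)
    (pow_ne_zero _ (one_pos.trans_le (one_le_gaussianSqMoment (by norm_num))).ne')
  have hMpos : 0 < M.toReal := ENNReal.toReal_pos hM0 hMtop
  refine ⟨6 * M.toReal, by positivity, fun n hn => ?_⟩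
  have hn' : (0 : ℝ) < n := by exact_mod_cast hn
  have hms : MeasurableSet {x : StepSpace H n | fluctuation n x < 6 * M.toReal * n ^ 2} :=
    (isOpen_lt (continuous_fluctuation n) continuous_const).measurableSet
  have hcompl : stdGaussian (StepSpace H n) {x | fluctuation n x < 6 * M.toReal * n ^ 2}ᶜ ≤ 1 / 2 := by
    have hε : ENNReal.ofReal (6 * M.toReal * n ^ 2) ≠ 0 := by
      simp only [ne_eq, ENNReal.ofReal_eq_zero, not_le]
      positivity
    have h := meas_ge_le_lintegral_div (μ := stdGaussian (StepSpace H n))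
      (f := fun x => ENNReal.ofReal (fluctuation n x))
      ((continuous_fluctuation n).measurable.ennreal_ofReal.aemeasurable) hε ENNReal.ofReal_ne_top
    refine (measure_mono fun x hx => ?_).trans (h.trans ?_)
    · exact ENNReal.ofReal_le_ofReal (not_lt.1 hx)
    · refine (ENNReal.div_le_div_right (lintegral_fluctuation_le n) _).trans ?_
      refine ENNReal.div_le_of_le_mul (le_of_eq ?_)
      rw [ENNReal.ofReal_mul (by positivity), ENNReal.ofReal_mul (by positivity),
        ENNReal.ofReal_toReal hMtop, ENNReal.ofReal_pow hn'.le, ENNReal.ofReal_natCast,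
        ENNReal.ofReal_ofNat, ← hM]
      have : (1 / 2 : ℝ≥0∞) * 6 = 3 := by
        rw [show (6 : ℝ≥0∞) = 2 * 3 by norm_num, ← mul_assoc, one_div,
          ENNReal.inv_mul_cancel two_ne_zero ENNReal.ofNat_ne_top, one_mul]
      calc 3 * (n : ℝ≥0∞) ^ 2 * M = 1 / 2 * 6 * (M * n ^ 2) := by rw [this]; ring
        _ = 1 / 2 * (6 * M * n ^ 2) := by ring
  rw [prob_compl_eq_one_sub hms] at hcompl
  rw [tsub_le_iff_left] at hcompl
  refine (ENNReal.add_le_add_iff_right (show (1 / 2 : ℝ≥0∞) ≠ ∞ by simp)).1 ?_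
  rwa [ENNReal.add_halves]

end Steps

/-! ### Probability bounds for the rescaled Gaussian walk -/

namespace CarnotGroup

variable {H V : Type*} [NormedAddCommGroup H] [InnerProductSpace ℝ H]
  [NormedAddCommGroup V] [NormedSpace ℝ V] [FiniteDimensional ℝ V] [FiniteDimensional ℝ H]

/-- The end point of the rescaled walk as a function of its steps. -/
def scaledWalk (B : StepTwoBracket H V) (n : ℕ) (x : StepSpace H n) : CarnotGroup B :=
  walk B (fun k => (n : ℝ)⁻¹ • stepL n k x) n

theorem continuous_scaledWalk (B : StepTwoBracket H V) (n : ℕ) : Continuous (scaledWalk B n) := by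
  refine continuous_of_coord ?_ ?_
  · simp only [scaledWalk, hor_walk]
    fun_prop
  · simp only [scaledWalk, ver_walk]
    refine continuous_const.smul (continuous_finsetSum _ fun k _ => continuous_br ?_ ?_) <;>
      fun_prop

variable {B : StepTwoBracket H V} [MeasurableSpace H] [BorelSpace H]

/-- Dilations are homomorphisms, so `dil n⁻¹` of the walk is the walk with rescaled steps, and the
first `n` steps are jointly a standard Gaussian vector. -/
theorem walkLaw_apply {Ω : Type*} [MeasurableSpace Ω] {P : Measure Ω} [IsProbabilityMeasure P]
    {X : ℕ → Ω → H} (hX : ∀ n, HasLaw (X n) (stdGaussian H) P) (hind : iIndepFun X P) (n : ℕ)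
    {S : Set (CarnotGroup B)} (hS : MeasurableSet S) :
    walkLaw B P X n S = stdGaussian (StepSpace H n) (scaledWalk B n ⁻¹' S) := by
  have hlaw := hasLaw_toLp_stdGaussian hX hind n
  have hm : Measurable (scaledWalk B n) := (continuous_scaledWalk B n).measurable
  have e : (fun ω => dil ((n : ℝ)⁻¹) (randomWalk B X n ω)) =
      scaledWalk B n ∘ fun ω => WithLp.toLp 2 fun i : Fin n => X i ω := by
    funext ω
    change dil _ (walk B (fun k => X k ω) n) = _
    rw [dil_walk, Function.comp_apply, scaledWalk]
    exact walk_congr fun k hk => by rw [stepL_of_lt hk]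
  rw [walkLaw, e, ← AEMeasurable.map_map_of_aemeasurable hm.aemeasurable hlaw.aemeasurable,
    hlaw.map_eq, Measure.map_apply hm hS]

/-- The upper bound for the probability that the walk ends far from the identity. -/
theorem exists_stdGaussian_wordNorm_scaledWalk_le (B : StepTwoBracket H V) {r α : ℝ} (hr : 0 < r)
    (hα : α < r ^ 2 / 2) :
    ∃ D : ℝ≥0∞, D ≠ ∞ ∧ ∀ᶠ n : ℕ in atTop,
      stdGaussian (StepSpace H n) {x | r ≤ wordNorm (scaledWalk B n x)} ≤
        D * ENNReal.ofReal (Real.exp (-(α * n))) := by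
  obtain ⟨C, hC0, hC⟩ := exists_wordNorm_le B
  -- One `ε` pays twice: for the exponent `θ = 1 - ε < 1`, needed for a finite moment, and for a
  -- vertical error of size `ε`.
  obtain ⟨ε, hε0, hε1, hεr, hεα⟩ : ∃ ε : ℝ, 0 < ε ∧ ε < 1 ∧ ε < r ∧
      α < (1 - ε) / 2 * (r - ε) ^ 2 := by
    have hcont : Continuous fun ε : ℝ => (1 - ε) / 2 * (r - ε) ^ 2 := by fun_prop
    have hlim := hcont.tendsto 0
    have h1 : ∀ᶠ ε : ℝ in 𝓝[>] 0, α < (1 - ε) / 2 * (r - ε) ^ 2 :=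
      (hlim.eventually_const_lt (by simpa [div_eq_inv_mul] using hα)).filter_mono nhdsWithin_le_nhds
    have h2 : ∀ᶠ ε : ℝ in 𝓝[>] 0, ε < 1 := (eventually_lt_nhds one_pos).filter_mono
      nhdsWithin_le_nhds
    have h3 : ∀ᶠ ε : ℝ in 𝓝[>] 0, ε < r := (eventually_lt_nhds hr).filter_mono
      nhdsWithin_le_nhds
    obtain ⟨ε, ⟨⟨h1, h2⟩, h3⟩, h4⟩ := (((h1.and h2).and h3).and eventually_mem_nhdsWithin).exists
    exact ⟨ε, h4, h2, h3, h1⟩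
  set d := Module.finrank ℝ H
  set κ : ℝ := (gaussianSqMoment (1 / 2) ^ d).toReal with hκ
  have hκtop : gaussianSqMoment (1 / 2) ^ d ≠ ∞ :=
    ENNReal.pow_ne_top (gaussianSqMoment_lt_top (by norm_num)).ne
  have hκpos : 0 < κ := ENNReal.toReal_pos
    (pow_ne_zero _ (one_pos.trans_le (one_le_gaussianSqMoment (by norm_num))).ne') hκtop
  -- Chosen so that `κ ^ n * exp (-(n R / 4)) ≤ exp (-(α n))`: the event `‖x‖² ≥ n R` is then
  -- negligible at rate `α`.
  set R : ℝ := max 0 (4 * (α + Real.log κ)) with hR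
  have hR0 : 0 ≤ R := le_max_left _ _
  -- The number of blocks depends only on `ε` and `R`. It makes the vertical error `C √(‖brL B‖ * (2
  -- R / m))` at most `ε`.
  obtain ⟨m', hm'⟩ := exists_nat_ge (C ^ 2 * (‖brL B‖ * (2 * R)) / ε ^ 2)
  set m := m' + 1 with hmdef
  have hm0 : (0 : ℝ) < m := by positivity
  have hm : C ^ 2 * (‖brL B‖ * (2 * R / m)) ≤ ε ^ 2 := by
    rw [div_le_iff₀ (by positivity)] at hm'
    have : C ^ 2 * (‖brL B‖ * (2 * R)) ≤ ε ^ 2 * m := by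
      have : (m : ℝ) = m' + 1 := by rw [hmdef]; push_cast; ring
      nlinarith [sq_nonneg ε]
    calc C ^ 2 * (‖brL B‖ * (2 * R / m)) = C ^ 2 * (‖brL B‖ * (2 * R)) / m := by ring
      _ ≤ _ := (div_le_iff₀ hm0).2 this
  refine ⟨gaussianSqMoment (1 - ε) ^ (m * d) + 1, ENNReal.add_ne_top.2
    ⟨ENNReal.pow_ne_top (gaussianSqMoment_lt_top (by linarith)).ne, ENNReal.one_ne_top⟩, ?_⟩
  filter_upwards [eventually_ge_atTop m] with n hn
  have hn0 : (0 : ℝ) < n := hm0.trans_le (by exact_mod_cast hn)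
  set l := n / m + 1 with hl
  have hl2 : (l : ℝ) ≤ 2 * n / m := by
    have h1 : ((n / m : ℕ) : ℝ) ≤ n / m := Nat.cast_div_le
    have h2 : (1 : ℝ) ≤ n / m := (one_le_div hm0).2 (by exact_mod_cast hn)
    rw [hl]
    push_cast
    linarith [show 2 * (n : ℝ) / m = n / m + n / m by ring]
  -- Since `l = n / m + 1` rounds up, `m` blocks of length `l` cover all `n` steps; the last ones
  -- may be short or empty.
  set b : ℕ → ℕ := fun j => min (j * l) n with hbdef
  have hb : Monotone b := fun i j hij => min_le_min_right _ (Nat.mul_le_mul_right _ hij)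
  have hb0 : b 0 = 0 := by simp [hbdef]
  have hbm : b m = n := min_eq_right (by
    have h1 := Nat.div_add_mod n m
    have h2 := Nat.mod_lt n (show m > 0 by omega)
    rw [hl, mul_add, mul_one]
    omega)
  have hbl : ∀ j, b (j + 1) - b j ≤ l := fun j => by
    simp only [hbdef, add_mul, one_mul]
    refine tsub_le_iff_right.2 ?_
    rw [add_comm l, ← min_add_add_right]
    exact min_le_min_left _ (Nat.le_add_right n l)
  have hsub : {x : StepSpace H n | r ≤ wordNorm (scaledWalk B n x)} ⊆
      {x | n * (r - ε) ^ 2 ≤ ‖blockL b n m x‖ ^ 2} ∪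
        {x | n * R ≤ ‖ContinuousLinearMap.id ℝ (StepSpace H n) x‖ ^ 2} := by
    intro x hx
    by_contra hcon
    rw [mem_union, not_or] at hcon
    obtain ⟨h1, h2⟩ := hcon
    simp only [mem_ofPred_eq, not_le, ContinuousLinearMap.id_apply] at h1 h2 hx
    have hw := wordNorm_walk_le_blocks hC0 hC (fun k => (n : ℝ)⁻¹ • stepL n k x) hb hb0 hbm hbl
    have h3 : ∑ j ∈ Finset.range m, ‖∑ i ∈ Finset.Ico (b j) (b (j + 1)), (n : ℝ)⁻¹ • stepL n i x‖
        < r - ε := by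
      simp only [← Finset.smul_sum, norm_smul, ← Finset.mul_sum]
      rw [norm_inv, Real.norm_of_nonneg hn0.le, inv_mul_lt_iff₀ hn0]
      have h4 : ‖blockL b n m x‖ < √n * (r - ε) := by
        refine lt_of_pow_lt_pow_left₀ 2 (mul_nonneg (Real.sqrt_nonneg _) (by linarith)) ?_
        rwa [mul_pow, Real.sq_sqrt hn0.le]
      calc _ ≤ √n * ‖blockL b n m x‖ := sum_norm_block_le hb hb0 hbm x
        _ < √n * (√n * (r - ε)) := by
          have := Real.sqrt_pos.2 hn0
          gcongr
        _ = n * (r - ε) := by rw [← mul_assoc, Real.mul_self_sqrt hn0.le]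
    have h5 : C * √(‖brL B‖ * (l * ∑ i ∈ Finset.range n, ‖(n : ℝ)⁻¹ • stepL n i x‖ ^ 2)) ≤ ε := by
      have h6 : l * ∑ i ∈ Finset.range n, ‖(n : ℝ)⁻¹ • stepL n i x‖ ^ 2 ≤ 2 * R / m := by
        simp only [norm_smul, mul_pow, ← Finset.mul_sum]
        rw [sum_norm_sq_stepL, norm_inv, Real.norm_of_nonneg hn0.le]
        calc (l : ℝ) * ((n : ℝ)⁻¹ ^ 2 * ‖x‖ ^ 2)
            ≤ 2 * n / m * ((n : ℝ)⁻¹ ^ 2 * (n * R)) := by gcongr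
          _ = 2 * R / m := by field_simp
      refine abs_le_of_sq_le_sq' ?_ hε0.le |>.2
      rw [mul_pow, Real.sq_sqrt (by positivity)]
      refine le_trans ?_ hm
      gcongr
    have : wordNorm (scaledWalk B n x) < r := hw.trans_lt (by linarith)
    linarith
  have hS1 := stdGaussian_le_norm_sq_contraction (blockL (H := H) b n m)
    (norm_blockL_le hb hb0 hbm) (θ := 1 - ε) (by linarith) (n * (r - ε) ^ 2)
  have hS2 := stdGaussian_le_norm_sq_contraction (ContinuousLinearMap.id ℝ (StepSpace H n))
    (fun x => le_rfl) (θ := 1 / 2) (by norm_num) (n * R)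
  rw [finrank_stepSpace] at hS1 hS2
  refine (measure_mono hsub).trans ((measure_union_le _ _).trans ?_)
  rw [add_mul, one_mul]
  refine add_le_add (hS1.trans ?_) (hS2.trans ?_)
  · refine mul_le_mul_right (ENNReal.ofReal_le_ofReal (Real.exp_le_exp.2 ?_)) _
    have := mul_le_mul_of_nonneg_right hεα.le hn0.le
    linarith
  · rw [mul_comm n, pow_mul, ← ENNReal.ofReal_toReal hκtop, ← hκ, ← ENNReal.ofReal_pow hκpos.le,
      ← ENNReal.ofReal_mul (by positivity)]
    refine ENNReal.ofReal_le_ofReal ?_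
    nth_rw 1 [← Real.exp_log hκpos]
    rw [← Real.exp_nat_mul, ← Real.exp_add, Real.exp_le_exp]
    have : 4 * (α + Real.log κ) ≤ R := le_max_right _ _
    nlinarith

/-- The lower bound for the probability that the walk ends close to a given point. -/
theorem eventually_le_stdGaussian_wordNorm_scaledWalk (x₀ : CarnotGroup B) {r ε : ℝ}
    (hr : wordNorm x₀ < r) (hε : 0 < ε) :
    ∀ᶠ n : ℕ in atTop, ENNReal.ofReal (1 / 2 * Real.exp (-(r ^ 2 / 2 * n))) ≤
      stdGaussian (StepSpace H n) {x | wordNorm (x₀⁻¹ * scaledWalk B n x) < ε} := by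
  obtain ⟨C, hC0, hC⟩ := exists_wordNorm_le B
  obtain ⟨γ, C₁, hγ, hγ0, hγ1⟩ := exists_homLip_of_wordNorm_lt 1 x₀ (r := r) (by simpa using hr)
  obtain ⟨c, hc0, hc⟩ := exists_half_le_stdGaussian_fluctuation H
  have hr0 : 0 ≤ r := hγ.nonneg_left
  have hC₁ : 0 ≤ C₁ := hγ.nonneg_right
  -- The three errors are the horizontal fluctuation, the vertical fluctuation, and the vertical
  -- defect of the discretized path.
  have hlim : Tendsto (fun n : ℕ => √c / √n + C * √(‖brL B‖ * (2 * (r * √c) + c) / √n)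
      + C * √(C₁ / n)) atTop (𝓝 0) := by
    have hs : Tendsto (fun n : ℕ => √(n : ℝ)) atTop atTop :=
      Real.tendsto_sqrt_atTop.comp tendsto_natCast_atTop_atTop
    have h1 := hs.const_div_atTop (√c)
    have h2 := (hs.const_div_atTop (‖brL B‖ * (2 * (r * √c) + c))).sqrt.const_mul C
    have h3 := (tendsto_natCast_atTop_atTop.const_div_atTop C₁).sqrt.const_mul C
    simpa using (h1.add h2).add h3
  filter_upwards [hlim.eventually_lt_const hε, eventually_gt_atTop 0] with n hn hnpos
  have hn0 : (0 : ℝ) < n := by exact_mod_cast hnpos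
  set g : ℕ → CarnotGroup B := fun k => γ (k / n) with hg
  set u' : ℕ → H := fun k => hor ((g k)⁻¹ * g (k + 1)) with hu'
  have hinc : ∀ k, ‖u' k‖ ≤ r / n ∧ ‖ver ((g k)⁻¹ * g (k + 1))‖ ≤ C₁ / n ^ 2 := fun k => by
    have h := hγ (k / n) ((k + 1 : ℕ) / n) (by gcongr; simp)
    rw [show ((k + 1 : ℕ) / n - k / n : ℝ) = 1 / n by push_cast; ring] at h
    exact ⟨h.1.trans_eq (by ring), h.2.trans_eq (by ring)⟩
  set p := ∑ k ∈ Finset.range n, ver ((g k)⁻¹ * g (k + 1)) with hp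
  have hx₀ : x₀ = walk B u' n * mk 0 p := by
    rw [← inv_mul_eq_walk_mul g n]
    simp [hg, hγ0, hγ1, div_self hn0.ne']
  have hpn : ‖p‖ ≤ C₁ / n := by
    refine (norm_sum_le_of_le _ fun k _ => (hinc k).2).trans_eq ?_
    rw [Finset.sum_const, Finset.card_range, nsmul_eq_mul]
    field_simp
  -- The factor `n` undoes the rescaling in `scaledWalk`. As `‖u' i‖ ≤ r / n`, each entry has norm
  -- at most `r`, so the Cameron–Martin cost is at most `n r² / 2`.
  set u : StepSpace H n := WithLp.toLp 2 fun i : Fin n => (n : ℝ) • u' i with hu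
  have hunorm : ‖u‖ ^ 2 ≤ n * r ^ 2 := by
    rw [PiLp.norm_sq_eq_of_L2]
    refine (Finset.sum_le_card_nsmul _ _ (r ^ 2) fun i _ => ?_).trans_eq (by simp)
    have : ‖u i‖ ≤ r := by
      change ‖(n : ℝ) • u' i‖ ≤ r
      rw [norm_smul, Real.norm_of_nonneg hn0.le]
      have := (le_div_iff₀ hn0).1 (hinc i).1
      linarith
    gcongr
  set A := {x : StepSpace H n | fluctuation n x < c * n ^ 2} with hA
  have hAm : MeasurableSet A := (isOpen_lt (continuous_fluctuation n) continuous_const).measurableSet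
  have hshift := exp_mul_stdGaussian_le_shift u hAm fun x => by
    simp only [hA, mem_ofPred_eq, fluctuation_neg]
  refine le_trans ?_ (hshift.trans (measure_mono fun x hx => ?_))
  · rw [mul_comm (1 / 2 : ℝ), ENNReal.ofReal_mul (Real.exp_pos _).le]
    refine mul_le_mul' (ENNReal.ofReal_le_ofReal (Real.exp_le_exp.2 (by linarith))) ?_
    refine le_trans (le_of_eq ?_) (hc n hnpos)
    rw [ENNReal.ofReal_div_of_pos two_pos, ENNReal.ofReal_one, ENNReal.ofReal_ofNat]
  · set y : ℕ → H := fun k => (n : ℝ)⁻¹ • stepL n k (x - u) with hy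
    have hw : scaledWalk B n x = walk B (fun k => u' k + y k) n := by
      refine walk_congr fun k hk => ?_
      have : stepL n k u = (n : ℝ) • u' k := by rw [stepL_of_lt hk]
      simp only [hy, map_sub, this, smul_sub, inv_smul_smul₀ hn0.ne']
      abel
    have hfl : fluctuation n (x - u) < c * n ^ 2 := hx
    unfold fluctuation at hfl
    have hf1 : 0 ≤ ∑ k ∈ Finset.range n, ‖∑ i ∈ Finset.range k, stepL n i (x - u)‖ ^ 2 := by
      positivity
    have hf2 : 0 ≤ ∑ k ∈ Finset.range n, n * ‖stepL n k (x - u)‖ ^ 2 := by positivity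
    have hf3 : 0 ≤ n * ‖∑ i ∈ Finset.range n, stepL n i (x - u)‖ ^ 2 := by positivity
    have hsq : ∀ v : H, ‖(n : ℝ)⁻¹ • v‖ ^ 2 = (n ^ 2 : ℝ)⁻¹ * ‖v‖ ^ 2 := fun v => by
      rw [norm_smul, mul_pow, norm_inv, Real.norm_of_nonneg hn0.le, inv_pow]
    -- The perturbation lemma is applied with `c / n²` and `L = r / n`, because the steps `y` and
    -- `u'` carry the factor `1 / n`.
    have hS : ∑ k ∈ Finset.range n, ‖∑ i ∈ Finset.range k, y i‖ ^ 2 ≤ c / n ^ 2 * n ^ 2 := by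
      simp only [hy, ← Finset.smul_sum, hsq, ← Finset.mul_sum]
      rw [inv_mul_le_iff₀ (by positivity), div_mul_cancel₀ _ (by positivity)]
      linarith
    have hY : ∑ k ∈ Finset.range n, ‖y k‖ ^ 2 ≤ c / n ^ 2 * n := by
      simp only [hy, hsq, ← Finset.mul_sum]
      rw [← Finset.mul_sum] at hf2 hfl
      rw [inv_mul_le_iff₀ (by positivity)]
      have h1 : n * ∑ k ∈ Finset.range n, ‖stepL n k (x - u)‖ ^ 2 ≤ n * (c * n) := by linarith
      refine (le_of_mul_le_mul_left h1 hn0).trans_eq ?_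
      field_simp
    have hver := norm_ver_inv_walk_mul_walk_add_le (B := B) (fun k _ => (hinc k).1) hS hY
      (by positivity)
    have hhor : ‖hor ((walk B u' n)⁻¹ * walk B (fun k => u' k + y k) n)‖ ≤ √c / √n := by
      rw [hor_inv_walk_mul_walk_add]
      simp only [hy, ← Finset.smul_sum]
      refine abs_le_of_sq_le_sq' ?_ (by positivity) |>.2
      rw [hsq, div_pow, Real.sq_sqrt hc0.le, Real.sq_sqrt hn0.le, inv_mul_le_iff₀ (by positivity)]
      have h1 : n * ‖∑ i ∈ Finset.range n, stepL n i (x - u)‖ ^ 2 ≤ n * (c * n) := by linarith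
      refine (le_of_mul_le_mul_left h1 hn0).trans_eq ?_
      field_simp
    set z := (walk B u' n)⁻¹ * walk B (fun k => u' k + y k) n with hz
    have hver' : ‖ver z‖ ≤ ‖brL B‖ * (2 * (r * √c) + c) / √n := by
      refine hver.trans_eq ?_
      have hsn := Real.sqrt_pos.2 hn0
      rw [Real.sqrt_div hc0.le, Real.sqrt_sq hn0.le]
      field_simp
      rw [Real.sq_sqrt hn0.le]
    have he : x₀⁻¹ * scaledWalk B n x = expH (hor z) * mk 0 (ver z) * mk 0 (-p) := by
      have hinv : (mk 0 p : CarnotGroup B)⁻¹ = mk 0 (-p) := by apply ext_coord <;> simp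
      rw [← eq_expH_mul_mk, hw, hz, hx₀, mul_inv_rev, hinv, mul_assoc, mk_zero_comm]
    change wordNorm (x₀⁻¹ * scaledWalk B n x) < ε
    rw [he]
    refine lt_of_le_of_lt ((hC _ _).trans (add_le_add ((hC _ _).trans (add_le_add
      ((wordNorm_expH_le _).trans hhor) ?_)) ?_)) hn
    · gcongr
    · rw [norm_neg]
      gcongr

end CarnotGroup

/-! ## Logarithmic asymptotics -/

theorem tendsto_inv_mul_log_mul_exp {c : ℝ} (hc : 0 < c) (α : ℝ) :
    Tendsto (fun n : ℕ => (((n : ℝ)⁻¹ : ℝ) : EReal) *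
      ENNReal.log (ENNReal.ofReal (c * Real.exp (-(α * n))))) atTop (𝓝 ((-α : ℝ) : EReal)) := by
  have h1 : Tendsto (fun n : ℕ => (n : ℝ)⁻¹ * Real.log c - α) atTop (𝓝 (-α)) := by
    simpa using ((tendsto_inv_atTop_nhds_zero_nat (𝕜 := ℝ)).mul_const (Real.log c)).sub_const α
  refine ((continuous_coe_real_ereal.tendsto _).comp h1).congr' ?_
  filter_upwards [eventually_gt_atTop 0] with n hn
  have hn0 : (n : ℝ) ≠ 0 := by exact_mod_cast hn.ne'
  rw [ENNReal.log_ofReal_of_pos (by positivity), ← EReal.coe_mul, Function.comp_apply,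
    Real.log_mul hc.ne' (Real.exp_pos _).ne', Real.log_exp]
  congr 1
  field_simp
  ring

theorem inv_mul_log_le_inv_mul_log (n : ℕ) {a b : ℝ≥0∞} (h : a ≤ b) :
    (((n : ℝ)⁻¹ : ℝ) : EReal) * ENNReal.log a ≤ (((n : ℝ)⁻¹ : ℝ) : EReal) * ENNReal.log b :=
  mul_le_mul_of_nonneg_left (ENNReal.log_monotone h)
    (EReal.coe_nonneg.2 (inv_nonneg.2 n.cast_nonneg))

theorem limsup_inv_mul_log_le {a : ℕ → ℝ≥0∞} {D : ℝ≥0∞} (hD : D ≠ ∞) {α : ℝ}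
    (h : ∀ᶠ n : ℕ in atTop, a n ≤ D * ENNReal.ofReal (Real.exp (-(α * n)))) :
    limsup (fun n : ℕ => (((n : ℝ)⁻¹ : ℝ) : EReal) * ENNReal.log (a n)) atTop ≤
      ((-α : ℝ) : EReal) := by
  -- The added `1` keeps the constant positive, and its logarithm meaningful, even when `D = 0`.
  have hc : 0 < D.toReal + 1 := by positivity
  rw [← (tendsto_inv_mul_log_mul_exp hc α).limsup_eq]
  refine limsup_le_limsup ?_
  filter_upwards [h] with n hn
  refine inv_mul_log_le_inv_mul_log n (hn.trans ?_)
  rw [ENNReal.ofReal_mul hc.le]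
  refine mul_le_mul_left ?_ _
  rw [← ENNReal.ofReal_toReal hD]
  exact ENNReal.ofReal_le_ofReal (by rw [ENNReal.toReal_ofReal ENNReal.toReal_nonneg]; linarith)

theorem le_liminf_inv_mul_log {a : ℕ → ℝ≥0∞} {c : ℝ} (hc : 0 < c) {α : ℝ}
    (h : ∀ᶠ n : ℕ in atTop, ENNReal.ofReal (c * Real.exp (-(α * n))) ≤ a n) :
    ((-α : ℝ) : EReal) ≤
      liminf (fun n : ℕ => (((n : ℝ)⁻¹ : ℝ) : EReal) * ENNReal.log (a n)) atTop := by
  rw [← (tendsto_inv_mul_log_mul_exp hc α).liminf_eq]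
  refine liminf_le_liminf ?_
  filter_upwards [h] with n hn using inv_mul_log_le_inv_mul_log n hn

/-! ## The large deviation principle -/

namespace CarnotGroup

variable {H V : Type*} [NormedAddCommGroup H] [InnerProductSpace ℝ H]
  [NormedAddCommGroup V] [NormedSpace ℝ V] [FiniteDimensional ℝ V] [FiniteDimensional ℝ H]
  {B : StepTwoBracket H V}

theorem dCC_sq_div_two (x : CarnotGroup B) :
    dCC x ^ 2 / 2 = ENNReal.ofReal (wordNorm x ^ 2 / 2) := by
  rw [dCC_eq, ENNReal.ofReal_div_of_pos two_pos, ENNReal.ofReal_pow (wordNorm_nonneg x),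
    ENNReal.ofReal_ofNat]

/-- The Carnot-Carathéodory topology is coarser than the Euclidean topology. -/
theorem isOpen_of_isOpen_ccTopology {O : Set (CarnotGroup B)} (hO : IsOpen[ccTopology B] O) :
    IsOpen O := by
  rw [isOpen_iff_mem_nhds]
  intro x hx
  obtain ⟨ε, hε, h⟩ := hO x hx
  obtain ⟨C, -, hC⟩ := exists_wordNorm_le B
  -- A Euclidean-continuous majorant of the distance to `x` that vanishes at `x`.
  let f : CarnotGroup B → ℝ := fun y => ‖hor (x⁻¹ * y)‖ + C * √‖ver (x⁻¹ * y)‖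
  have hf : Continuous f := by
    have h1 := continuous_hor (B := B)
    have h2 := continuous_ver (B := B)
    have h3 : Continuous fun y : CarnotGroup B => B.br (hor x⁻¹) (hor y) :=
      continuous_br continuous_const h1
    simp only [f, hor_mul, ver_mul]
    fun_prop
  have h0 : f x = 0 := by simp [f, B.br_self]
  have hlim : Tendsto (fun y => ENNReal.ofReal (f y)) (𝓝 x) (𝓝 0) := by
    have := (ENNReal.continuous_ofReal.comp hf).tendsto x
    rwa [Function.comp_apply, h0, ENNReal.ofReal_zero] at this
  filter_upwards [hlim.eventually_lt_const hε] with y hy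
  refine h y (lt_of_le_of_lt ?_ hy)
  rw [rhoCC_eq]
  refine ENNReal.ofReal_le_ofReal ?_
  conv_lhs => rw [eq_expH_mul_mk (x⁻¹ * y)]
  exact (hC _ _).trans (add_le_add (wordNorm_expH_le _) le_rfl)

theorem isRateFunction_dCC (B : StepTwoBracket H V) :
    IsRateFunction (ccTopology B) fun x : CarnotGroup B => dCC x ^ 2 / 2 := by
  refine ⟨⟨1, (dCC_sq_div_two 1).trans_ne ENNReal.ofReal_ne_top⟩, fun a => ?_⟩
  rw [← @isOpen_compl_iff]
  intro x hx
  have hmem : ∀ y : CarnotGroup B, y ∈ {y : CarnotGroup B | dCC y ^ 2 / 2 ≤ a}ᶜ ↔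
      √(2 * a) < wordNorm y := fun y => by
    rw [mem_compl_iff, mem_ofPred_eq, dCC_sq_div_two, ← ENNReal.ofReal_coe_nnreal,
      ENNReal.ofReal_le_ofReal_iff a.coe_nonneg, ← not_le, Real.le_sqrt (wordNorm_nonneg y),
      div_le_iff₀ two_pos, mul_comm (2 : ℝ)]
    positivity
  rw [hmem] at hx
  refine ⟨ENNReal.ofReal (wordNorm x - √(2 * a)),
    ENNReal.ofReal_pos.2 (sub_pos.2 hx), fun y hy => ?_⟩
  rw [rhoCC_eq, ENNReal.ofReal_lt_ofReal_iff_of_nonneg (wordNorm_nonneg _)] at hy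
  rw [hmem]
  have h1 := wordNorm_mul_le y (y⁻¹ * x)
  have h2 := wordNorm_inv_le (x⁻¹ * y)
  rw [mul_inv_cancel_left] at h1
  rw [mul_inv_rev, inv_inv] at h2
  linarith

variable [MeasurableSpace H] [BorelSpace H]

/-- Open sets contain small balls around each of their points, and closed sets avoid every ball
about the identity on which the rate is below its infimum over the set. The two bounds for
`scaledWalk` therefore suffice, and the Euclidean comparison supplies measurability. -/
theorem satisfiesLDP_walkLaw (B : StepTwoBracket H V) {Ω : Type*} [MeasurableSpace Ω]
    (P : Measure Ω) [IsProbabilityMeasure P] {X : ℕ → Ω → H}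
    (hX : ∀ n, HasLaw (X n) (stdGaussian H) P) (hind : iIndepFun X P) :
    SatisfiesLDP (ccTopology B) (walkLaw B P X) fun x => dCC x ^ 2 / 2 := by
  refine ⟨isRateFunction_dCC B, fun O hO => ?_, fun F hF => ?_⟩
  · have hOm : MeasurableSet O := (isOpen_of_isOpen_ccTopology hO).measurableSet
    set Λ := liminf (fun n : ℕ => (((n : ℝ)⁻¹ : ℝ) : EReal) *
      ENNReal.log (walkLaw B P X n O)) atTop with hΛ
    have key : ∀ x ∈ O, ∀ r, wordNorm x < r → ((-(r ^ 2 / 2) : ℝ) : EReal) ≤ Λ := by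
      intro x hx r hr
      obtain ⟨ε, hε, h⟩ := hO x hx
      refine le_liminf_inv_mul_log (c := 1 / 2) (by norm_num) ?_
      obtain ⟨ε', hε'0, hε'⟩ : ∃ ε' : ℝ, 0 < ε' ∧ ENNReal.ofReal ε' ≤ ε := by
        rcases eq_or_ne ε ∞ with rfl | ht
        · exact ⟨1, one_pos, le_top⟩
        · exact ⟨ε.toReal, ENNReal.toReal_pos hε.ne' ht, ENNReal.ofReal_toReal_le⟩
      filter_upwards [eventually_le_stdGaussian_wordNorm_scaledWalk x hr hε'0] with n hn
      rw [walkLaw_apply hX hind n hOm]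
      refine hn.trans (measure_mono fun z hz => h _ ?_)
      rw [rhoCC_eq]
      exact ((ENNReal.ofReal_lt_ofReal_iff hε'0).2 hz).trans_le hε'
    have key' : ∀ x ∈ O, ((-(wordNorm x ^ 2 / 2) : ℝ) : EReal) ≤ Λ := by
      intro x hx
      have hlim : Tendsto (fun r : ℝ => ((-(r ^ 2 / 2) : ℝ) : EReal)) (𝓝[>] wordNorm x)
          (𝓝 ((-(wordNorm x ^ 2 / 2) : ℝ) : EReal)) := by
        have : Continuous fun r : ℝ => ((-(r ^ 2 / 2) : ℝ) : EReal) :=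
          continuous_coe_real_ereal.comp (by fun_prop)
        exact (this.tendsto _).mono_left nhdsWithin_le_nhds
      exact le_of_tendsto hlim (eventually_mem_nhdsWithin.mono fun r hr => key x hx r hr)
    rw [EReal.neg_le]
    by_contra hcon
    rw [not_le] at hcon
    have hnn : (0 : EReal) ≤ -Λ := (EReal.coe_ennreal_nonneg _).trans hcon.le
    rw [← EReal.coe_toENNReal hnn, EReal.coe_ennreal_lt_coe_ennreal_iff] at hcon
    simp only [iInf_lt_iff] at hcon
    obtain ⟨x, hx, hlt⟩ := hcon
    rw [← EReal.coe_ennreal_lt_coe_ennreal_iff, EReal.coe_toENNReal hnn, dCC_sq_div_two,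
      EReal.coe_ennreal_ofReal, max_eq_left (by positivity), EReal.lt_neg_comm, ← EReal.coe_neg]
      at hlt
    exact absurd (key' x hx) (not_le.2 hlt)
  · have hFm : MeasurableSet F := by
      have h1 := isOpen_of_isOpen_ccTopology (@IsClosed.isOpen_compl _ (ccTopology B) F hF)
      exact h1.measurableSet.of_compl
    have hprob : ∀ n, walkLaw B P X n F ≤ 1 := fun n => by
      rw [walkLaw_apply hX hind n hFm]
      exact prob_le_one
    set Λ := limsup (fun n : ℕ => (((n : ℝ)⁻¹ : ℝ) : EReal) *
      ENNReal.log (walkLaw B P X n F)) atTop with hΛ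
    rw [EReal.le_neg]
    by_contra hcon
    rw [not_le] at hcon
    obtain ⟨a, ha1, ha2⟩ := EReal.lt_iff_exists_real_btwn.1 hcon
    have hle : Λ ≤ ((-a : ℝ) : EReal) := by
      -- A negative `a` is covered by the trivial bound of probabilities by `1`. Otherwise a second
      -- real `a' > a` below the infimum fixes the radius `√(2 a')`, leaving the strict gap that the
      -- tail estimate at rate `a` requires.
      rcases lt_or_ge a 0 with ha | ha
      · refine limsup_inv_mul_log_le ENNReal.one_ne_top (Eventually.of_forall fun n => ?_)
        refine (hprob n).trans ?_
        rw [one_mul, ENNReal.one_le_ofReal]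
        refine Real.one_le_exp ?_
        nlinarith [n.cast_nonneg (α := ℝ)]
      · obtain ⟨a', ha'1, ha'2⟩ := EReal.lt_iff_exists_real_btwn.1 ha2
        have haa' : a < a' := EReal.coe_lt_coe_iff.1 ha'1
        have hr0 : 0 < √(2 * a') := Real.sqrt_pos.2 (by linarith)
        have hr2 : √(2 * a') ^ 2 / 2 = a' := by rw [Real.sq_sqrt (by linarith)]; ring
        obtain ⟨D, hD, hn⟩ := exists_stdGaussian_wordNorm_scaledWalk_le B hr0
          (α := a) (by rwa [hr2])
        refine limsup_inv_mul_log_le hD (hn.mono fun n hn => le_trans ?_ hn)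
        rw [walkLaw_apply hX hind n hFm]
        refine measure_mono fun z hz => ?_
        have h1 : (a' : EReal) < ((dCC (scaledWalk B n z) ^ 2 / 2 : ℝ≥0∞) : EReal) :=
          ha'2.trans_le (EReal.coe_ennreal_le_coe_ennreal_iff.2 (iInf₂_le (f := fun x (_ : x ∈ F) => dCC x ^ 2 / 2) _ hz))
        rw [dCC_sq_div_two, EReal.coe_ennreal_ofReal, max_eq_left (by positivity),
          EReal.coe_lt_coe_iff] at h1
        exact Real.sqrt_le_iff.2 ⟨wordNorm_nonneg _, by linarith⟩
    have := EReal.neg_le_neg_iff.2 hle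
    rw [EReal.coe_neg, neg_neg] at this
    exact absurd ha1 (not_lt.2 this)

end CarnotGroup

end

/-- `Nontrivial V` says that the step of the group is two, not one. -/
theorem corollary3p13 {H V : Type*}
    [NormedAddCommGroup H] [InnerProductSpace ℝ H] [FiniteDimensional ℝ H]
    [MeasurableSpace H] [BorelSpace H]
    [NormedAddCommGroup V] [NormedSpace ℝ V] [FiniteDimensional ℝ V] [Nontrivial V]
    (B : StepTwoBracket H V)
    {Ω : Type*} [MeasurableSpace Ω] (P : Measure Ω) [IsProbabilityMeasure P]
    (X : ℕ → Ω → H) (hX : ∀ n, HasLaw (X n) (stdGaussian H) P) (hind : iIndepFun X P) :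
    (∀ x : CarnotGroup B, CarnotGroup.dCC x ≠ ∞) ∧
    (∀ x : CarnotGroup B,
      rateJ (stdGaussian H) x
        = (⨅ γ ∈ CarnotGroup.horizontalPaths 1 x, CarnotGroup.energy γ / 2)) ∧
    (∀ x : CarnotGroup B, rateJ (stdGaussian H) x = CarnotGroup.dCC x ^ 2 / 2) ∧
    SatisfiesLDP (CarnotGroup.ccTopology B) (walkLaw B P X)
      (fun x => CarnotGroup.dCC x ^ 2 / 2) := by
  refine ⟨fun x => ?_, rateJ_stdGaussian, fun x => ?_, CarnotGroup.satisfiesLDP_walkLaw B P hX hind⟩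
  · rw [CarnotGroup.dCC_eq]
    exact ENNReal.ofReal_ne_top
  · rw [rateJ_stdGaussian, CarnotGroup.iInf_energy_eq]
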